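/- Let $\mathcal S$ be the Selberg class: the set of functions $F$ for which there is a Dirichlet series with $F(s)=\sum_{n\ge1}a_n n^{-s}$, absolutely convergent for $\Re s>1$, such that 1. $(s-1)^mF(s)$ extends to an entire function of finite order for some integer $m\ge 0$; 2. $a_n\ll_\varepsilon n^{\varepsilon}$ for every $\varepsilon>0$; 3. there is a gamma factor $\gamma(s)=\epsilon Q^s\prod_{i=1}^k\Gamma(w_is+\mu_i)$ with $k\ge 0$, $|\epsilon|=1$, $Q>0$, $w_i>0$, $\Re\mu_i\ge 0$ which is admissible for $F$, that is, $\Phi(s)=\gamma(s)F(s)$ satisfies $\Phi(s)=\overline{\Phi(1-\bar s)}$ as an identity of meromorphic functions; 4. $a_1=1$ and $\log F(s)=\sum_{n\ge1}b_nn^{-s}$ for $\Re s>1$, where $b_n=0$ unless $n$ is a positive power of a prime and $b_n\ll n^{\theta}$ for some $\theta<1/2$. The degree of $F\in\mathcal S$ is $d_F=2\sum_{i=1}^kw_i$, computed from any admissible gamma factor for $F$. A function $F\in\mathcal S$ is called primitive if, whenever $F=F_1F_2$ with $F_1,F_2\in\mathcal S$, one has $F_1=1$ or $F_2=1$. (Equalities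 of members of $\mathcal S$ are equalities of meromorphic functions.) If $F\in\mathcal S$ and $d_F<2$, then $F$ is primitive. -/

import Mathlib

open scoped ComplexConjugate

/-- The data `ε, Q, w₁, …, w_k, μ₁, …, μ_k` of a gamma factor. The number `k` of gamma functions
may be `0`. -/
structure GammaFactor where
  k : ℕ
  eps : ℂ
  Q : ℝ
  w : Fin k → ℝ
  mu : Fin k → ℂ
  norm_eps : ‖eps‖ = 1
  Q_pos : 0 < Q
  w_pos : ∀ i, 0 < w i
  re_mu_nonneg : ∀ i, 0 ≤ (mu i).re

namespace GammaFactor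

/-- `γ(s) = ε Q^s ∏ Γ(wᵢ s + μᵢ)`. -/
noncomputable def toFun (g : GammaFactor) (s : ℂ) : ℂ :=
  g.eps * (g.Q : ℂ) ^ s * ∏ i, Complex.Gamma ((g.w i : ℂ) * s + g.mu i)

/-- `s` is a pole of one of the functions `Γ(wᵢ s + μᵢ)`, i.e. `wᵢ s + μᵢ ∈ {0, -1, -2, …}`
for some `i`. -/
def IsPole (g : GammaFactor) (s : ℂ) : Prop :=
  ∃ (i : Fin g.k) (n : ℕ), (g.w i : ℂ) * s + g.mu i = -(n : ℂ)

/-- The degree `2 ∑ wᵢ` of a gamma factor. -/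
noncomputable def degree (g : GammaFactor) : ℝ := 2 * ∑ i, g.w i

/-- `g` is an admissible gamma factor for `F`: the function `Φ(s) = γ(s) F(s)` satisfies
`Φ(s) = conj (Φ (1 - conj s))`. This is an identity of meromorphic functions; it is required at
every point `s` at which both sides are defined, i.e. neither `s` nor `1 - conj s` is a pole of the
gamma factor or the possible pole `1` of `F` (note `1 - conj s = 1` iff `s = 0`). -/
def Admissible (g : GammaFactor) (F : ℂ → ℂ) : Prop :=
  ∀ s : ℂ, s ≠ 0 → s ≠ 1 → ¬ g.IsPole s → ¬ g.IsPole (1 - conj s) →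
    g.toFun s * F s = conj (g.toFun (1 - conj s) * F (1 - conj s))

end GammaFactor

/-- An entire function of finite order. -/
def IsEntireOfFiniteOrder (E : ℂ → ℂ) : Prop :=
  Differentiable ℂ E ∧
    ∃ ρ : ℝ, E =O[Filter.cocompact ℂ] fun s : ℂ => Real.exp (‖s‖ ^ ρ)

/-- The function `F`, given by the Dirichlet series `∑ a n / n ^ s` on `Re s > 1`, satisfies the
axioms of the Selberg class. Members of the class are meromorphic functions on `ℂ` whose only
possible pole is `s = 1`; such a function is represented by a function `ℂ → ℂ` whose value at the
single point `1` is irrelevant (no axiom refers to it). -/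
structure SelbergAxioms (F : ℂ → ℂ) (a : ℕ → ℂ) : Prop where
  dirichlet_series : ∀ s : ℂ, 1 < s.re → LSeriesHasSum a s (F s)
  analyticity : ∃ (m : ℕ) (E : ℂ → ℂ), IsEntireOfFiniteOrder E ∧
    ∀ s : ℂ, s ≠ 1 → E s = (s - 1) ^ m * F s
  ramanujan : ∀ ε : ℝ, 0 < ε → a =O[Filter.atTop] fun n : ℕ => (n : ℝ) ^ ε
  functional_equation : ∃ g : GammaFactor, g.Admissible F
  coeff_one : a 1 = 1
  /-- `log F(s) = ∑ b n / n ^ s`. As `b 1 = 0`, the series is the branch of `log F` on `Re s > 1`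
  that tends to `0` as `Re s → ∞`. -/
  euler_product : ∃ (b : ℕ → ℂ) (θ : ℝ), θ < 1 / 2 ∧
    (∀ n : ℕ, ¬ IsPrimePow n → b n = 0) ∧
    (b =O[Filter.atTop] fun n : ℕ => (n : ℝ) ^ θ) ∧
    ∀ s : ℂ, 1 < s.re → LSeriesSummable b s ∧ F s = Complex.exp (LSeries b s)

/-- The Selberg class `𝓢`. -/
def SelbergClass : Set (ℂ → ℂ) := {F | ∃ a : ℕ → ℂ, SelbergAxioms F a}

/-- `d` is the degree `d_F` of `F`: the degree of an admissible gamma factor for `F`. -/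
def HasDegree (F : ℂ → ℂ) (d : ℝ) : Prop :=
  ∃ g : GammaFactor, g.Admissible F ∧ g.degree = d

/-- `F ∈ 𝓢` is primitive if `F = F₁ F₂` with `F₁, F₂ ∈ 𝓢` implies `F₁ = 1` or `F₂ = 1`. Equality
of members of `𝓢` as meromorphic functions is equality away from the possible pole `1`. -/
def IsPrimitive (F : ℂ → ℂ) : Prop :=
  F ∈ SelbergClass ∧
    ∀ F₁ ∈ SelbergClass, ∀ F₂ ∈ SelbergClass,
      (∀ s : ℂ, s ≠ 1 → F s = F₁ s * F₂ s) →
        (∀ s : ℂ, s ≠ 1 → F₁ s = 1) ∨ (∀ s : ℂ, s ≠ 1 → F₂ s = 1)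

/-! ### Quotients of gamma values at points symmetric about the critical line -/

namespace Complex

/-! The degree is superadditive and the only member of degree less than `1` is `1`; so if `F = F₁
F₂` has degree less than `2`, one factor has degree less than `1` and is trivial.

Superadditivity (`GammaFactor.Admissible.degree_add_le`): the functional equation gives `|F((1 - σ)
+ it)| ≈ |t| ^ ((σ - 1/2) d) |F(σ + it)|`, up to an error in the exponent that does not depend on
`σ`. For fixed large `σ`, compare exponents for `F` and for `F₁ F₂` as `t → ∞`; then let `σ → ∞`.

Degree `d < 1` (`SelbergAxioms.eq_one_of_degree_lt_one`): far to the left `F` grows in `t` with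
exponent about `dσ`. A contour integral against a kernel that isolates the `n`-th coefficient, moved
to `Re s = 1 - σ`, gains `n ^ (-σ)` and loses about `n ^ (dσ)`. Hence `a n` decays faster than any
power of `n`, and the Dirichlet series is entire and bounded on every vertical line. A gamma
function in the functional equation would force growth on left lines, so `k = 0`.

The decay passes to the logarithm: for fixed `k`, `b (p ^ k) ≪ p⁻²`. Together with `b n ≪ n ^ θ`, `θ
< 1/2`, this makes the series of `log F` converge absolutely at `1/2`, so `|F|` is bounded above and
below on `Re s ≥ 1/2`. The functional equation `|F(s)| = Q ^ (1 - 2 Re s) |F(1 - conj s)|` then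
bounds `F` (if `Q ≤ 1`) or `1/F` (if `Q ≥ 1`) on all of `ℂ`. By Liouville `F` is constant, equal to
`a 1 = 1`. -/

theorem norm_betaIntegral_le (u : ℂ) (b : ℝ) :
    ‖betaIntegral u b‖ ≤ ‖betaIntegral (u.re : ℂ) b‖ := by
  have h1 : ∀ x ∈ Set.Ioo (0 : ℝ) 1, ∀ v : ℂ,
      ‖(x : ℂ) ^ (v - 1) * (1 - (x : ℂ)) ^ ((b : ℂ) - 1)‖ = x ^ (v.re - 1) * (1 - x) ^ (b - 1) := by
    intro x hx v
    have h2 : (1 - (x : ℂ)) = ((1 - x : ℝ) : ℂ) := by push_cast; ring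
    rw [norm_mul, norm_cpow_eq_rpow_re_of_pos hx.1, h2,
      norm_cpow_eq_rpow_re_of_pos (by linarith [hx.2])]
    simp
  have h3 : betaIntegral (u.re : ℂ) b =
      ((∫ x in (0 : ℝ)..1, x ^ (u.re - 1) * (1 - x) ^ (b - 1) : ℝ) : ℂ) := by
    unfold betaIntegral
    rw [← intervalIntegral.integral_ofReal]
    apply intervalIntegral.integral_congr_Ioo_of_le zero_le_one
    intro x hx
    have h2 : (1 - (x : ℂ)) = ((1 - x : ℝ) : ℂ) := by push_cast; ring
    simp only [h2]
    rw [ofReal_mul, ofReal_cpow hx.1.le, ofReal_cpow (by linarith [hx.2])]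
    push_cast; ring
  rw [h3, norm_real, Real.norm_of_nonneg]
  · unfold betaIntegral
    refine (intervalIntegral.norm_integral_le_integral_norm zero_le_one).trans (le_of_eq ?_)
    apply intervalIntegral.integral_congr_Ioo_of_le zero_le_one
    intro x hx
    exact h1 x hx u
  · apply intervalIntegral.integral_nonneg zero_le_one
    intro x hx
    exact mul_nonneg (Real.rpow_nonneg hx.1 _) (Real.rpow_nonneg (by linarith [hx.2]) _)

/-- Write `Γ(u) Γ(b) = Γ(u + b) B(u, b)` at `u` and at `Re u`. The modulus of the beta integrand
depends only on `Re u`, so `|B(u, b)| ≤ B(Re u, b)`, and `Γ(b)` cancels. -/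
theorem norm_Gamma_mul_le {u : ℂ} {b : ℝ} (hu : 0 < u.re) (hb : 0 < b) :
    ‖Gamma u‖ * Real.Gamma (u.re + b) ≤ ‖Gamma (u + b)‖ * Real.Gamma u.re := by
  have h1 := Gamma_mul_Gamma_eq_betaIntegral (s := u) (t := b) hu (by simpa using hb)
  have h2 := Gamma_mul_Gamma_eq_betaIntegral (s := (u.re : ℂ)) (t := b) (by simpa using hu)
    (by simpa using hb)
  have hB := norm_betaIntegral_le u b
  have hGb := Real.Gamma_pos_of_pos hb
  have hGu := Real.Gamma_pos_of_pos hu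
  have hGub := Real.Gamma_pos_of_pos (add_pos hu hb)
  rw [← ofReal_add, Gamma_ofReal, Gamma_ofReal, Gamma_ofReal] at h2
  rw [Gamma_ofReal] at h1
  have e1 := congrArg norm h1
  have e2 := congrArg norm h2
  simp only [norm_mul, norm_real, Real.norm_of_nonneg hGb.le, Real.norm_of_nonneg hGu.le,
    Real.norm_of_nonneg hGub.le] at e1 e2
  have h3 : ‖Gamma u‖ * Real.Gamma b * Real.Gamma (u.re + b) ≤
      ‖Gamma (u + b)‖ * (Real.Gamma u.re * Real.Gamma b) := by
    rw [e1, e2]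
    calc _ ≤ ‖Gamma (u + b)‖ * ‖betaIntegral (u.re : ℂ) b‖ * Real.Gamma (u.re + b) := by gcongr
      _ = _ := by ring
  nlinarith

/-- The constant is uniform in `Im u`. This takes the place of Stirling's formula: a real shift is
rounded to an integer one, to which the recurrence of `Γ` applies. -/
theorem exists_norm_Gamma_le {r b : ℝ} (hr : 0 < r) (hb : 0 ≤ b) :
    ∃ C : ℝ, 0 < C ∧ ∀ u : ℂ, u.re = r → ‖Gamma u‖ ≤ C * ‖Gamma (u + b)‖ := by
  rcases hb.eq_or_lt with rfl | hb
  · exact ⟨1, one_pos, fun u _ => by simp⟩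
  have h1 := Real.Gamma_pos_of_pos hr
  have h2 := Real.Gamma_pos_of_pos (add_pos hr hb)
  refine ⟨Real.Gamma r / Real.Gamma (r + b), by positivity, fun u hu => ?_⟩
  have := norm_Gamma_mul_le (u := u) (by rwa [hu]) hb
  rw [hu] at this
  rw [div_mul_eq_mul_div, le_div_iff₀ h2]
  linarith

theorem Gamma_add_natCast {z : ℂ} (hz : z.im ≠ 0) (n : ℕ) :
    Gamma (z + n) = Gamma z * ∏ j ∈ Finset.range n, (z + j) := by
  induction n with
  | zero => simp
  | succ n ih =>
    have h : z + n ≠ 0 := fun h => hz (by simpa using congrArg im h)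
    rw [Finset.prod_range_succ, ← mul_assoc, ← ih, Nat.cast_succ, ← add_assoc, Gamma_add_one _ h,
      mul_comm]

/-- Upper bound for the quotient of two values of `Γ(w s + μ)` at points symmetric about the line
`Re s = 1 / 2`. -/
theorem exists_norm_Gamma_le_reflect {w : ℝ} (hw : 0 < w) {μ : ℂ} (hμ : 0 ≤ μ.re) {σ : ℝ}
    (hσ : 1 ≤ σ) : ∃ C : ℝ, 0 < C ∧ ∀ᶠ x in Filter.atTop, ∀ t : ℝ, |t| = x →
      ‖Gamma (w * (σ + t * I) + μ)‖ ≤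
        C * |t| ^ (w * (2 * σ - 1) + 1) * ‖Gamma (w * ((1 - σ : ℝ) + t * I) + μ)‖ := by
  -- The two arguments of `Γ` differ by the real number `a`. Rounding `a` up to `N` costs a
  -- constant, and `Γ(z + N) / Γ(z)` is a product of `N ≤ a + 1` factors of size `O(|t|)`.
  set a := w * (2 * σ - 1) with ha
  have ha0 : 0 ≤ a := mul_nonneg hw.le (by linarith)
  set N := ⌈a⌉₊ with hN
  have hb : 0 ≤ (N : ℝ) - a := by linarith [Nat.le_ceil a]
  have hNa : (N : ℝ) ≤ a + 1 := (Nat.ceil_lt_add_one ha0).le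
  have hr : 0 < w * σ + μ.re := by have := mul_pos hw (by linarith : 0 < σ); linarith
  obtain ⟨C, hC, hCle⟩ := exists_norm_Gamma_le hr hb
  set D := w * (1 + σ) + ‖μ‖ + w + N with hD
  have hD0 : 0 < D := by positivity
  refine ⟨C * D ^ N, by positivity, ?_⟩
  filter_upwards [Filter.eventually_ge_atTop 1, Filter.eventually_gt_atTop (‖μ‖ / w)]
    with x hx1 hxμ t ht
  subst ht
  set z : ℂ := w * ((1 - σ : ℝ) + t * I) + μ with hz
  have hza : (w * (σ + t * I) + μ : ℂ) = z + a := by rw [hz, ha]; push_cast; ring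
  have him : z.im = w * t + μ.im := by simp [hz]
  have himne : z.im ≠ 0 := by
    rw [him]
    intro h
    have h1 : |w * t| = |μ.im| := by rw [← abs_neg μ.im]; congr 1; linarith
    rw [abs_mul, abs_of_pos hw] at h1
    have h2 := abs_im_le_norm μ
    rw [div_lt_iff₀ hw] at hxμ
    linarith
  rw [hza]
  have h1 := hCle (z + a) (by simp [hz, ha]; ring)
  have h2 : z + a + ((N - a : ℝ) : ℂ) = z + (N : ℂ) := by push_cast; ring
  rw [h2, Gamma_add_natCast himne, norm_mul, norm_prod] at h1
  have h3 : ∏ j ∈ Finset.range N, ‖z + j‖ ≤ (D * |t|) ^ N := by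
    calc _ ≤ ∏ j ∈ Finset.range N, (D * |t|) := by
          apply Finset.prod_le_prod (fun _ _ => norm_nonneg _)
          intro j hj
          have hjN : (j : ℝ) ≤ N := by exact_mod_cast (Finset.mem_range.1 hj).le
          have h4 : ‖z‖ ≤ w * (|1 - σ| + |t|) + ‖μ‖ := by
            rw [hz]
            refine (norm_add_le _ _).trans ?_
            gcongr
            rw [norm_mul, norm_real, Real.norm_of_nonneg hw.le]
            gcongr
            refine (norm_add_le _ _).trans ?_
            simp [norm_real, -ofReal_sub, -ofReal_one]
          have h5 : |1 - σ| ≤ 1 + σ := by rw [abs_le]; constructor <;> linarith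
          have h6 : ‖z + j‖ ≤ ‖z‖ + j := (norm_add_le _ _).trans (by simp)
          have h7 : w * |1 - σ| ≤ w * (1 + σ) := by gcongr
          have h8 : (w * (1 + σ) + ‖μ‖ + N) * 1 ≤ (w * (1 + σ) + ‖μ‖ + N) * |t| := by
            gcongr
          rw [hD]
          nlinarith
      _ = _ := by simp
  have h9 : |t| ^ N ≤ |t| ^ (a + 1) := by
    rw [← Real.rpow_natCast]
    exact Real.rpow_le_rpow_of_exponent_le hx1 hNa
  calc _ ≤ C * (‖Gamma z‖ * ∏ j ∈ Finset.range N, ‖z + j‖) := h1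
    _ ≤ C * (‖Gamma z‖ * (D ^ N * |t| ^ (a + 1))) := by
        rw [mul_pow] at h3
        gcongr
        exact h3.trans (by gcongr)
    _ = _ := by ring

/-- Lower bound for the quotient of two values of `Γ(w s + μ)` at points symmetric about the line
`Re s = 1 / 2`. -/
theorem exists_le_norm_Gamma_reflect {w : ℝ} (hw : 0 < w) {μ : ℂ} (hμ : 0 ≤ μ.re) {σ : ℝ}
    (hσ : 1 ≤ σ) (hwσ : 1 ≤ w * σ) : ∃ c : ℝ, 0 < c ∧ ∀ᶠ x in Filter.atTop, ∀ t : ℝ, |t| = x →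
      c * |t| ^ (w * (2 * σ - 1) - 1) * ‖Gamma (w * ((1 - σ : ℝ) + t * I) + μ)‖ ≤
        ‖Gamma (w * (σ + t * I) + μ)‖ := by
  set a := w * (2 * σ - 1) with ha
  have ha0 : 0 ≤ a := mul_nonneg hw.le (by linarith)
  set M := ⌊a⌋₊ with hM
  have hb : 0 ≤ a - M := by linarith [Nat.floor_le ha0]
  have hMa : a - 1 ≤ M := by linarith [Nat.lt_floor_add_one a]
  -- Here `a` is rounded down, so `z + M` must already lie in the right half-plane. This holds
  -- because `M > a - 1` and `w (1 - σ) + a = w σ ≥ 1`.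
  have hr : 0 < w * (1 - σ) + μ.re + M := by
    have h1 := Nat.lt_floor_add_one a
    have h2 : a = w * (1 - σ) + (2 * (w * σ) + w * (σ - 2)) - w * 0 := by rw [ha]; ring
    have h3 : w * (1 - σ) + a = w * σ := by rw [ha]; ring
    linarith
  obtain ⟨C, hC, hCle⟩ := exists_norm_Gamma_le hr hb
  refine ⟨C⁻¹ * (w / 2) ^ M, by positivity, ?_⟩
  filter_upwards [Filter.eventually_ge_atTop 1, Filter.eventually_gt_atTop (2 * ‖μ‖ / w)]
    with x hx1 hxμ t ht
  subst ht
  set z : ℂ := w * ((1 - σ : ℝ) + t * I) + μ with hz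
  have hza : (w * (σ + t * I) + μ : ℂ) = z + a := by rw [hz, ha]; push_cast; ring
  have him : z.im = w * t + μ.im := by simp [hz]
  have hlow : w / 2 * |t| ≤ |z.im| := by
    have h1 : |w * t| ≤ |z.im| + |μ.im| := by
      have : w * t = z.im - μ.im := by rw [him]; ring
      rw [this]; exact abs_sub _ _
    rw [abs_mul, abs_of_pos hw] at h1
    have h2 := abs_im_le_norm μ
    rw [div_lt_iff₀ hw] at hxμ
    linarith
  have himne : z.im ≠ 0 := by
    intro h
    rw [h, abs_zero] at hlow
    nlinarith
  rw [hza]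
  have h1 := hCle (z + M) (by simp [hz])
  have h2 : z + M + ((a - M : ℝ) : ℂ) = z + (a : ℂ) := by push_cast; ring
  rw [h2, Gamma_add_natCast himne, norm_mul, norm_prod] at h1
  have h3 : (w / 2 * |t|) ^ M ≤ ∏ j ∈ Finset.range M, ‖z + j‖ := by
    calc _ = ∏ j ∈ Finset.range M, (w / 2 * |t|) := by simp
      _ ≤ _ := by
          apply Finset.prod_le_prod (fun _ _ => by positivity)
          intro j _
          refine hlow.trans ?_
          have := abs_im_le_norm (z + j)
          simpa using this
  have h9 : |t| ^ (a - 1) ≤ |t| ^ M := by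
    rw [← Real.rpow_natCast]
    exact Real.rpow_le_rpow_of_exponent_le hx1 hMa
  calc _ = C⁻¹ * (‖Gamma z‖ * ((w / 2) ^ M * |t| ^ (a - 1))) := by ring
    _ ≤ C⁻¹ * (‖Gamma z‖ * ∏ j ∈ Finset.range M, ‖z + j‖) := by
        rw [mul_pow] at h3
        gcongr
        refine le_trans (by gcongr) h3
    _ ≤ C⁻¹ * (C * ‖Gamma (z + a)‖) := by gcongr
    _ = _ := by field_simp

end Complex

/-! ### Gamma factors and the functional equation on vertical lines -/

namespace GammaFactor

open Complex Filter

theorem degree_nonneg (g : GammaFactor) : 0 ≤ g.degree :=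
  mul_nonneg zero_le_two (Finset.sum_nonneg fun i _ => (g.w_pos i).le)

theorem eventually_im_ne (g : GammaFactor) (i : Fin g.k) :
    ∀ᶠ x in atTop, ∀ t : ℝ, |t| = x → ∀ σ : ℝ, ((g.w i : ℂ) * (σ + t * I) + g.mu i).im ≠ 0 := by
  filter_upwards [eventually_gt_atTop (‖g.mu i‖ / g.w i)] with x hx t ht σ h
  subst ht
  have hw := g.w_pos i
  have him : g.w i * t + (g.mu i).im = 0 := by simpa using h
  have h1 : |g.w i * t| = |(g.mu i).im| := by rw [← abs_neg (g.mu i).im]; congr 1; linarith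
  rw [abs_mul, abs_of_pos hw] at h1
  have h2 := abs_im_le_norm (g.mu i)
  rw [div_lt_iff₀ hw] at hx
  linarith

theorem eventually_not_isPole (g : GammaFactor) :
    ∀ᶠ x in atTop, ∀ t : ℝ, |t| = x → ∀ σ : ℝ, ¬ g.IsPole (σ + t * I) := by
  filter_upwards [eventually_all.2 g.eventually_im_ne] with x hx t ht σ
  rintro ⟨i, n, h⟩
  refine hx i t ht σ ?_
  rw [h]; simp

theorem eventually_toFun_ne_zero (g : GammaFactor) :
    ∀ᶠ x in atTop, ∀ t : ℝ, |t| = x → ∀ σ : ℝ, g.toFun (σ + t * I) ≠ 0 := by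
  filter_upwards [eventually_all.2 g.eventually_im_ne] with x hx t ht σ
  unfold toFun
  refine mul_ne_zero (mul_ne_zero ?_ ?_) (Finset.prod_ne_zero_iff.2 fun i _ => ?_)
  · rw [← norm_ne_zero_iff, g.norm_eps]; exact one_ne_zero
  · rw [← norm_ne_zero_iff, norm_cpow_eq_rpow_re_of_pos g.Q_pos]
    exact (Real.rpow_pos_of_pos g.Q_pos _).ne'
  · refine Gamma_ne_zero fun n h => hx i t ht σ ?_
    rw [h]; simp

theorem norm_toFun (g : GammaFactor) (s : ℂ) :
    ‖g.toFun s‖ = g.Q ^ s.re * ∏ i, ‖Gamma ((g.w i : ℂ) * s + g.mu i)‖ := by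
  unfold toFun
  rw [norm_mul, norm_mul, g.norm_eps, norm_cpow_eq_rpow_re_of_pos g.Q_pos, norm_prod, one_mul]

theorem prod_rpow_eq (g : GammaFactor) (σ e : ℝ) {x : ℝ} (hx : 0 < x) :
    ∏ i, x ^ (g.w i * (2 * σ - 1) + e) = x ^ ((σ - 1 / 2) * g.degree + e * g.k) := by
  rw [← Real.rpow_sum_of_pos hx]
  congr 1
  rw [Finset.sum_add_distrib, ← Finset.sum_mul]
  simp [degree]; ring

/-- Each gamma function contributes an error of `1` to the exponent. The total `g.k` is independent
of `σ`, hence harmless as `σ → ∞`. -/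
theorem exists_norm_toFun_le (g : GammaFactor) {σ : ℝ} (hσ : 1 ≤ σ) :
    ∃ C : ℝ, 0 < C ∧ ∀ᶠ x in atTop, ∀ t : ℝ, |t| = x →
      ‖g.toFun (σ + t * I)‖ ≤
        C * |t| ^ ((σ - 1 / 2) * g.degree + g.k) * ‖g.toFun ((1 - σ : ℝ) + t * I)‖ := by
  choose C hC hev using fun i => exists_norm_Gamma_le_reflect (g.w_pos i) (g.re_mu_nonneg i) hσ
  have hQ := g.Q_pos
  refine ⟨g.Q ^ (2 * σ - 1) * ∏ i, C i,
    mul_pos (Real.rpow_pos_of_pos hQ _) (Finset.prod_pos fun i _ => hC i), ?_⟩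
  filter_upwards [eventually_all.2 hev, eventually_gt_atTop 0] with x hx hx0 t ht
  have ht0 : 0 < |t| := ht ▸ hx0
  rw [norm_toFun, norm_toFun]
  have h1 := Finset.prod_le_prod (s := Finset.univ) (fun i _ => norm_nonneg _)
    fun i _ => hx i t ht
  rw [Finset.prod_mul_distrib, Finset.prod_mul_distrib, g.prod_rpow_eq σ 1 ht0, one_mul] at h1
  have e1 : ((σ : ℂ) + t * I).re = (1 - σ) + (2 * σ - 1) := by simp; ring
  have e2 : (((1 - σ : ℝ) : ℂ) + t * I).re = 1 - σ := by simp
  rw [e1, e2, Real.rpow_add hQ]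
  have hQ2 : 0 ≤ g.Q ^ (1 - σ) * g.Q ^ (2 * σ - 1) := by positivity
  refine (mul_le_mul_of_nonneg_left h1 hQ2).trans_eq ?_
  ring

theorem exists_le_norm_toFun (g : GammaFactor) : ∀ᶠ σ : ℝ in atTop,
    ∃ c : ℝ, 0 < c ∧ ∀ᶠ x in atTop, ∀ t : ℝ, |t| = x →
      c * |t| ^ ((σ - 1 / 2) * g.degree - g.k) * ‖g.toFun ((1 - σ : ℝ) + t * I)‖ ≤
        ‖g.toFun (σ + t * I)‖ := by
  have hev0 : ∀ᶠ σ : ℝ in atTop, ∀ i, 1 ≤ g.w i * σ := by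
    refine eventually_all.2 fun i => ?_
    filter_upwards [eventually_ge_atTop (1 / g.w i)] with σ h
    rwa [div_le_iff₀' (g.w_pos i)] at h
  filter_upwards [hev0, eventually_ge_atTop 1] with σ hw hσ
  choose C hC hev using fun i => exists_le_norm_Gamma_reflect (g.w_pos i) (g.re_mu_nonneg i) hσ
    (hw i)
  have hQ := g.Q_pos
  refine ⟨g.Q ^ (2 * σ - 1) * ∏ i, C i,
    mul_pos (Real.rpow_pos_of_pos hQ _) (Finset.prod_pos fun i _ => hC i), ?_⟩
  filter_upwards [eventually_all.2 hev, eventually_gt_atTop 0] with x hx hx0 t ht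
  have ht0 : 0 < |t| := ht ▸ hx0
  rw [norm_toFun, norm_toFun]
  have h1 := Finset.prod_le_prod (s := Finset.univ)
    (fun i _ => mul_nonneg (mul_nonneg (hC i).le (Real.rpow_nonneg ht0.le _)) (norm_nonneg _))
    fun i _ => hx i t ht
  simp only [sub_eq_add_neg _ (1 : ℝ)] at h1
  have h2 := g.prod_rpow_eq σ (-1) ht0
  simp only [sub_eq_add_neg _ (1 : ℝ)] at h2
  rw [Finset.prod_mul_distrib, Finset.prod_mul_distrib, h2, neg_one_mul, ← sub_eq_add_neg] at h1
  have e1 : ((σ : ℂ) + t * I).re = (1 - σ) + (2 * σ - 1) := by simp; ring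
  have e2 : (((1 - σ : ℝ) : ℂ) + t * I).re = 1 - σ := by simp
  rw [e1, e2, Real.rpow_add hQ]
  have hQ2 : 0 ≤ g.Q ^ (1 - σ) * g.Q ^ (2 * σ - 1) := by positivity
  refine le_of_eq_of_le ?_ (mul_le_mul_of_nonneg_left h1 hQ2)
  ring

/-- The reflection `s ↦ 1 - conj s` preserves the imaginary part, and for large `|t|` no pole lies
at that height. -/
theorem Admissible.eventually_norm_eq {g : GammaFactor} {F : ℂ → ℂ} (h : g.Admissible F) :
    ∀ᶠ x in atTop, ∀ t : ℝ, |t| = x → ∀ σ : ℝ,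
      ‖g.toFun (σ + t * I)‖ * ‖F (σ + t * I)‖ =
        ‖g.toFun ((1 - σ : ℝ) + t * I)‖ * ‖F ((1 - σ : ℝ) + t * I)‖ := by
  filter_upwards [g.eventually_not_isPole, eventually_gt_atTop 0] with x hx hx0 t ht σ
  have ht0 : t ≠ 0 := by rw [← abs_pos, ht]; exact hx0
  have e : 1 - conj ((σ : ℂ) + t * I) = ((1 - σ : ℝ) : ℂ) + t * I := by
    simp; ring
  have hne : ∀ r : ℂ, r.im = 0 → (σ : ℂ) + t * I ≠ r := fun r hr h => ht0 (by
    have := congrArg im h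
    simpa [hr] using this)
  have := h (σ + t * I) (hne 0 rfl) (hne 1 rfl) (hx t ht σ) (by rw [e]; exact hx t ht _)
  rw [e] at this
  have := congrArg norm this
  simpa [-ofReal_sub] using this

end GammaFactor

open Complex Filter in
theorem GammaFactor.Admissible.exists_norm_le {g : GammaFactor} {F : ℂ → ℂ} (h : g.Admissible F)
    {σ : ℝ} (hσ : 1 ≤ σ) :
    ∃ C : ℝ, 0 < C ∧ ∀ᶠ x in atTop, ∀ t : ℝ, |t| = x →
      ‖F ((1 - σ : ℝ) + t * I)‖ ≤
        C * |t| ^ ((σ - 1 / 2) * g.degree + g.k) * ‖F (σ + t * I)‖ := by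
  obtain ⟨C, hC, hev⟩ := g.exists_norm_toFun_le hσ
  refine ⟨C, hC, ?_⟩
  filter_upwards [hev, h.eventually_norm_eq, g.eventually_toFun_ne_zero] with x h1 h2 h3 t ht
  have hpos := norm_pos_iff.2 (h3 t ht (1 - σ))
  refine le_of_mul_le_mul_left ?_ hpos
  rw [← h2 t ht σ]
  refine (mul_le_mul_of_nonneg_right (h1 t ht) (norm_nonneg _)).trans_eq (by ring)

open Complex Filter in
theorem GammaFactor.Admissible.exists_le_norm {g : GammaFactor} {F : ℂ → ℂ} (h : g.Admissible F) :
    ∀ᶠ σ : ℝ in atTop, ∃ c : ℝ, 0 < c ∧ ∀ᶠ x in atTop, ∀ t : ℝ, |t| = x →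
      c * |t| ^ ((σ - 1 / 2) * g.degree - g.k) * ‖F (σ + t * I)‖ ≤
        ‖F ((1 - σ : ℝ) + t * I)‖ := by
  filter_upwards [g.exists_le_norm_toFun] with σ hσ
  obtain ⟨c, hc, hev⟩ := hσ
  refine ⟨c, hc, ?_⟩
  filter_upwards [hev, h.eventually_norm_eq, g.eventually_toFun_ne_zero] with x h1 h2 h3 t ht
  have hpos := norm_pos_iff.2 (h3 t ht (1 - σ))
  refine le_of_mul_le_mul_left ?_ hpos
  rw [← h2 t ht σ]
  refine le_of_eq_of_le (by ring) (mul_le_mul_of_nonneg_right (h1 t ht) (norm_nonneg _))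

/-! ### Superadditivity of the degree -/

theorem Real.le_of_eventually_mul_rpow_le {c C e e' : ℝ} (hc : 0 < c)
    (h : ∀ᶠ x : ℝ in Filter.atTop, c * x ^ e ≤ C * x ^ e') : e ≤ e' := by
  by_contra! hlt
  have h1 := tendsto_rpow_atTop (sub_pos.2 hlt)
  obtain ⟨x, hx, hx1, hx0⟩ := (h.and ((h1.eventually_gt_atTop (C / c)).and
    (Filter.eventually_gt_atTop (0 : ℝ)))).exists
  rw [Real.rpow_sub hx0, div_lt_div_iff₀ hc (Real.rpow_pos_of_pos hx0 _)] at hx1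
  linarith

open Complex Filter in
/-- The degree is superadditive; in particular it does not depend on the gamma factor. -/
theorem GammaFactor.Admissible.degree_add_le {g g₁ g₂ : GammaFactor} {F F₁ F₂ : ℂ → ℂ}
    (h : g.Admissible F) (h₁ : g₁.Admissible F₁) (h₂ : g₂.Admissible F₂)
    (hmul : ∀ s : ℂ, s ≠ 1 → F s = F₁ s * F₂ s) (hne : ∀ s : ℂ, 1 < s.re → F s ≠ 0) :
    g₁.degree + g₂.degree ≤ g.degree := by
  -- For fixed `σ`, the lower bounds for `F₁`, `F₂` and the upper bound for `F` share the nonzero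
  -- factor `|F(σ + ix)|`. After cancelling it, only powers of `x` remain.
  have key : ∀ᶠ σ : ℝ in atTop, (σ - 1 / 2) * g₁.degree - g₁.k + ((σ - 1 / 2) * g₂.degree - g₂.k) ≤
      (σ - 1 / 2) * g.degree + g.k := by
    filter_upwards [h₁.exists_le_norm, h₂.exists_le_norm, eventually_gt_atTop 1]
      with σ hσ1 hσ2 hσ
    obtain ⟨c₁, hc₁, hev₁⟩ := hσ1
    obtain ⟨c₂, hc₂, hev₂⟩ := hσ2
    obtain ⟨C, hC, hev⟩ := h.exists_norm_le hσ.le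
    refine Real.le_of_eventually_mul_rpow_le (C := C) (mul_pos hc₁ hc₂) ?_
    filter_upwards [hev₁, hev₂, hev, eventually_gt_atTop 0] with x h1 h2 h3 hx0
    have hx : |x| = x := abs_of_pos hx0
    have h1 := h1 x hx
    have h2 := h2 x hx
    have h3 := h3 x hx
    rw [hx] at h1 h2 h3
    have hne1 : ∀ τ : ℝ, (τ : ℂ) + x * I ≠ 1 := fun τ h => hx0.ne' (by simpa using congrArg im h)
    rw [hmul _ (hne1 _), hmul _ (hne1 _), norm_mul, norm_mul] at h3
    have hF : 0 < ‖F₁ (σ + x * I)‖ * ‖F₂ (σ + x * I)‖ := by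
      rw [← norm_mul, ← hmul _ (hne1 _)]
      exact norm_pos_iff.2 (hne _ (by simpa using hσ))
    refine le_of_mul_le_mul_right ?_ hF
    rw [Real.rpow_add hx0]
    refine le_trans (le_of_eq_of_le (by ring) (mul_le_mul h1 h2 (by positivity) (by positivity))) h3
  -- Both sides of `key` are affine in `σ`, so their slopes compare.
  by_contra! hlt
  have h1 : Tendsto (fun σ : ℝ => (σ - 1 / 2) * (g₁.degree + g₂.degree - g.degree)) atTop atTop :=
    (tendsto_atTop_add_const_right _ _ tendsto_id).atTop_mul_const (sub_pos.2 hlt)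
  obtain ⟨σ, hσ, hσ'⟩ := (key.and (h1.eventually_gt_atTop (g.k + g₁.k + g₂.k : ℝ))).exists
  nlinarith

/-! ### Bounds in the half-plane of absolute convergence -/

namespace SelbergAxioms

open Complex Filter

variable {F : ℂ → ℂ} {a : ℕ → ℂ}

theorem ne_zero (h : SelbergAxioms F a) {s : ℂ} (hs : 1 < s.re) : F s ≠ 0 := by
  obtain ⟨b, θ, -, -, -, hb⟩ := h.euler_product
  rw [(hb s hs).2]
  exact exp_ne_zero _

/-- `|F| = exp (Re log F)`, and the absolutely convergent series of `log F` is bounded uniformly in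
`t`. -/
theorem exists_le_norm (h : SelbergAxioms F a) {σ : ℝ} (hσ : 1 < σ) :
    ∃ c : ℝ, 0 < c ∧ ∀ t : ℝ, c ≤ ‖F (σ + t * I)‖ := by
  obtain ⟨b, θ, -, -, -, hb⟩ := h.euler_product
  refine ⟨Real.exp (-∑' n, ‖LSeries.term b σ n‖), Real.exp_pos _, fun t => ?_⟩
  have hs := hb (σ + t * I) (by simpa using hσ)
  rw [hs.2, norm_exp, Real.exp_le_exp, neg_le]
  have h1 : ∀ n, ‖LSeries.term b (σ + t * I) n‖ = ‖LSeries.term b σ n‖ := fun n => by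
    rw [LSeries.norm_term_eq, LSeries.norm_term_eq]; simp
  calc -(LSeries b (σ + t * I)).re ≤ ‖LSeries b (σ + t * I)‖ :=
        (neg_le_abs _).trans (abs_re_le_norm _)
    _ ≤ ∑' n, ‖LSeries.term b (σ + t * I) n‖ := norm_tsum_le_tsum_norm hs.1.norm
    _ = _ := by simp_rw [h1]

theorem lseriesSummable (h : SelbergAxioms F a) {s : ℂ} (hs : 1 < s.re) : LSeriesSummable a s :=
  (h.dirichlet_series s hs).LSeriesSummable

theorem eq_LSeries (h : SelbergAxioms F a) {s : ℂ} (hs : 1 < s.re) : F s = LSeries a s :=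
  (h.dirichlet_series s hs).LSeries_eq.symm

end SelbergAxioms

/-! ### Vertical integrals and a kernel with compactly supported transform -/

namespace Complex

open Filter MeasureTheory Topology

theorem integrable_vertical {f : ℂ → ℂ} (hf : Continuous f) {c C : ℝ}
    (hC : ∀ t : ℝ, ‖f (c + t * I)‖ ≤ C * (1 + t ^ 2)⁻¹) :
    Integrable fun t : ℝ => f (c + t * I) :=
  (integrable_inv_one_add_sq.const_mul C).mono'
    (by fun_prop : Continuous fun t : ℝ => f (c + t * I)).aestronglyMeasurable
    (Eventually.of_forall hC)

theorem norm_integral_vertical_le {f : ℂ → ℂ} {c C : ℝ}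
    (hC : ∀ t : ℝ, ‖f (c + t * I)‖ ≤ C * (1 + t ^ 2)⁻¹) :
    ‖∫ t : ℝ, f (c + t * I)‖ ≤ C * Real.pi := by
  have := norm_integral_le_of_norm_le (integrable_inv_one_add_sq.const_mul C)
    (Eventually.of_forall hC)
  rwa [integral_const_mul, integral_univ_inv_one_add_sq] at this

/-- The integral over a vertical line of an entire function decaying like `1 / t ^ 2` in a strip
does not depend on the line. -/
theorem integral_vertical_eq {f : ℂ → ℂ} (hf : Differentiable ℂ f) {a b C : ℝ} (hab : a ≤ b)
    (hC : ∀ x ∈ Set.Icc a b, ∀ t : ℝ, ‖f (x + t * I)‖ ≤ C * (1 + t ^ 2)⁻¹) :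
    ∫ t : ℝ, f (a + t * I) = ∫ t : ℝ, f (b + t * I) := by
  have hia := integrable_vertical hf.continuous (hC a ⟨le_rfl, hab⟩)
  have hib := integrable_vertical hf.continuous (hC b ⟨hab, le_rfl⟩)
  have ta := intervalIntegral_tendsto_integral hia tendsto_neg_atTop_atBot tendsto_id
  have tb := intervalIntegral_tendsto_integral hib tendsto_neg_atTop_atBot tendsto_id
  have hsub := tb.sub ta
  have h0 : Tendsto (fun T : ℝ => (∫ t in -T..T, f (b + t * I)) - ∫ t in -T..T, f (a + t * I))
      atTop (𝓝 0) := by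
    have hlim : Tendsto (fun T : ℝ => 2 * (C * (1 + T ^ 2)⁻¹ * |b - a|)) atTop (𝓝 0) := by
      have : Tendsto (fun T : ℝ => (1 + T ^ 2)⁻¹) atTop (𝓝 0) :=
        tendsto_inv_atTop_zero.comp (tendsto_atTop_add_const_left _ _
          (tendsto_pow_atTop two_ne_zero))
      simpa using ((this.const_mul C).mul_const |b - a|).const_mul 2
    refine squeeze_zero_norm (fun T => ?_) hlim
    have hrect := integral_boundary_rect_eq_zero_of_differentiableOn f (a + (-T : ℝ) * I)
      (b + T * I) hf.differentiableOn
    have e1 : ((a : ℂ) + (-T : ℝ) * I).re = a := by simp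
    have e2 : ((a : ℂ) + (-T : ℝ) * I).im = -T := by simp
    have e3 : ((b : ℂ) + T * I).re = b := by simp
    have e4 : ((b : ℂ) + T * I).im = T := by simp
    rw [e1, e2, e3, e4] at hrect
    have hh : ∀ S : ℝ, S ^ 2 = T ^ 2 →
        ‖∫ x in a..b, f (x + S * I)‖ ≤ C * (1 + T ^ 2)⁻¹ * |b - a| := by
      intro S hS
      refine intervalIntegral.norm_integral_le_of_norm_le_const fun x hx => ?_
      rw [Set.uIoc_of_le hab] at hx
      rw [← hS]
      exact hC x ⟨hx.1.le, hx.2⟩ S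
    have h1 := hh (-T) (by ring)
    have h2 := hh T rfl
    have h3 : (∫ t in -T..T, f (b + t * I)) - ∫ t in -T..T, f (a + t * I) =
        I * ((∫ x in a..b, f (x + (-T : ℝ) * I)) - ∫ x in a..b, f (x + T * I)) := by
      simp only [smul_eq_mul] at hrect
      linear_combination (-I) * hrect +
        ((∫ t in -T..T, f (b + t * I)) - ∫ t in -T..T, f (a + t * I)) * I_mul_I
    rw [h3, norm_mul, norm_I, one_mul]
    exact (norm_sub_le _ _).trans (by linarith)
  exact (sub_eq_zero.1 (tendsto_nhds_unique hsub h0)).symm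

/-- The entire function `sinh w / w`. -/
noncomputable def sinhc (w : ℂ) : ℂ := dslope sinh 0 w

theorem differentiable_sinhc : Differentiable ℂ sinhc := by
  have : DifferentiableOn ℂ (dslope sinh 0) Set.univ :=
    (differentiableOn_dslope Filter.univ_mem).2 differentiable_sinh.differentiableOn
  exact differentiableOn_univ.1 this

theorem mul_sinhc (w : ℂ) : w * sinhc w = sinh w := by
  have := sub_smul_dslope sinh 0 w
  simpa [sinhc] using this

theorem norm_mul_norm_sinhc_le (w : ℂ) : ‖w‖ * ‖sinhc w‖ ≤ Real.exp |w.re| := by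
  rw [← norm_mul, mul_sinhc, sinh, norm_div, RCLike.norm_ofNat, div_le_iff₀ two_pos]
  refine (norm_sub_le _ _).trans ?_
  rw [norm_exp, norm_exp, neg_re]
  have := Real.exp_le_exp.2 (le_abs_self w.re)
  have := Real.exp_le_exp.2 (neg_le_abs w.re)
  linarith

theorem exists_norm_sinhc_le (k : ℝ) :
    ∃ C : ℝ, 0 < C ∧ ∀ w : ℂ, |w.re| ≤ k → (1 + ‖w‖) * ‖sinhc w‖ ≤ C := by
  obtain ⟨D, hD⟩ := (isCompact_closedBall (0 : ℂ) 1).exists_bound_of_continuousOn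
    differentiable_sinhc.continuous.continuousOn
  refine ⟨max (2 * D) (2 * Real.exp k), lt_max_of_lt_right (by positivity), fun w hw => ?_⟩
  rcases le_total ‖w‖ 1 with h | h
  · have := hD w (by simpa using h)
    refine le_max_of_le_left ?_
    nlinarith [norm_nonneg (sinhc w)]
  · have h1 := norm_mul_norm_sinhc_le w
    have h2 := Real.exp_le_exp.2 hw
    refine le_max_of_le_right ?_
    nlinarith [norm_nonneg (sinhc w)]

theorem sinhc_mul_I (t : ℝ) : sinhc (t * I) = (Real.sinc t : ℂ) := by
  rcases eq_or_ne t 0 with rfl | ht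
  · simp [sinhc]
  · have h := mul_sinhc (t * I)
    rw [sinh_mul_I] at h
    have ht' : (t : ℂ) ≠ 0 := ofReal_ne_zero.2 ht
    rw [Real.sinc_of_ne_zero ht, ofReal_div, ofReal_sin]
    field_simp
    refine mul_right_cancel₀ I_ne_zero ?_
    rw [← h]; ring

theorem two_div_pi_le_sinc {t : ℝ} (h0 : 0 ≤ t) (h1 : t ≤ 1) : 2 / Real.pi ≤ Real.sinc t := by
  rcases h0.eq_or_lt with rfl | h0
  · rw [Real.sinc_zero, div_le_one Real.pi_pos]
    exact Real.two_le_pi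
  · rw [Real.sinc_of_ne_zero h0.ne', le_div_iff₀ h0]
    exact Real.mul_le_sin h0.le (by linarith [Real.two_le_pi])

end Complex

namespace Complex

open Filter MeasureTheory Topology

/-- In the strip `sinhc (z / N) ≪ 1 / (1 + ‖z‖ / N)`, while `1 + ‖z‖ ≤ N (1 + ‖z‖ / N)`. So each
power of `1 + ‖z‖` costs a factor `N`; two extra powers provide the integrable weight. -/
theorem exists_norm_sinhc_pow_mul_le (k : ℝ) {M B : ℕ} (hMB : M + 2 ≤ B) :
    ∃ C : ℝ, 0 < C ∧ ∀ N : ℝ, 1 ≤ N → ∀ z : ℂ, |z.re| ≤ k →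
      ‖sinhc (z / N)‖ ^ B * (1 + ‖z‖) ^ M ≤ C * N ^ (M + 2) * (1 + z.im ^ 2)⁻¹ := by
  obtain ⟨C, hC, hCle⟩ := exists_norm_sinhc_le k
  refine ⟨C ^ B, by positivity, fun N hN z hz => ?_⟩
  have hN0 : 0 < N := by linarith
  have hre : |(z / N).re| ≤ k := by
    rw [div_ofReal_re, abs_div, abs_of_pos hN0]
    exact (div_le_self (abs_nonneg _) hN).trans hz
  have h1 := hCle _ hre
  rw [norm_div, norm_real, Real.norm_of_nonneg hN0.le] at h1
  set q := 1 + ‖z‖ / N with hq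
  have hq1 : 1 ≤ q := by rw [hq]; have : 0 ≤ ‖z‖ / N := by positivity
                         linarith
  have h2 : 1 + ‖z‖ ≤ N * q := by
    rw [hq, mul_add, mul_div_cancel₀ _ hN0.ne']
    linarith
  have h3 : 1 + z.im ^ 2 ≤ (1 + ‖z‖) ^ 2 := by
    have := abs_im_le_norm z
    have := sq_abs z.im
    nlinarith [abs_nonneg z.im, norm_nonneg z]
  rw [← div_eq_mul_inv, le_div_iff₀ (by positivity)]
  calc _ ≤ ‖sinhc (z / N)‖ ^ B * (1 + ‖z‖) ^ M * (1 + ‖z‖) ^ 2 := by gcongr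
    _ = ‖sinhc (z / N)‖ ^ B * (1 + ‖z‖) ^ (M + 2) := by ring
    _ ≤ ‖sinhc (z / N)‖ ^ B * (N * q) ^ (M + 2) := by gcongr
    _ = ‖sinhc (z / N)‖ ^ B * q ^ (M + 2) * N ^ (M + 2) := by
        rw [mul_pow, mul_assoc, mul_comm (q ^ _)]
    _ ≤ ‖sinhc (z / N)‖ ^ B * q ^ B * N ^ (M + 2) := by gcongr
    _ = (q * ‖sinhc (z / N)‖) ^ B * N ^ (M + 2) := by rw [mul_pow, mul_comm (q ^ _)]
    _ ≤ _ := by gcongr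

/-- A kernel whose integrals over vertical lines vanish unless `L` is small. -/
noncomputable def splineKernel (m B : ℕ) (N L : ℝ) (z : ℂ) : ℂ :=
  z ^ m * sinhc (z / N) ^ B * exp (L * z)

theorem differentiable_splineKernel (m B : ℕ) (N L : ℝ) :
    Differentiable ℂ (splineKernel m B N L) := by
  have := differentiable_sinhc
  unfold splineKernel
  fun_prop

theorem norm_splineKernel (m B : ℕ) (N L : ℝ) (z : ℂ) : ‖splineKernel m B N L z‖ =
    ‖z‖ ^ m * ‖sinhc (z / N)‖ ^ B * Real.exp (L * z.re) := by
  simp [splineKernel, norm_exp]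

theorem exists_norm_splineKernel_le {m B : ℕ} (hmB : m + 2 ≤ B) {N : ℝ} (hN : 1 ≤ N) (L k : ℝ) :
    ∃ C : ℝ, ∀ z : ℂ, |z.re| ≤ k → ‖splineKernel m B N L z‖ ≤ C * (1 + z.im ^ 2)⁻¹ := by
  obtain ⟨C, hC, hCle⟩ := exists_norm_sinhc_pow_mul_le k hmB
  refine ⟨C * N ^ (m + 2) * Real.exp (|L| * k), fun z hz => ?_⟩
  rw [norm_splineKernel]
  have h1 : L * z.re ≤ |L| * k := by
    refine (le_abs_self _).trans ?_
    rw [abs_mul]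
    gcongr
  calc _ ≤ (1 + ‖z‖) ^ m * ‖sinhc (z / N)‖ ^ B * Real.exp (|L| * k) := by
        gcongr; linarith
    _ = ‖sinhc (z / N)‖ ^ B * (1 + ‖z‖) ^ m * Real.exp (|L| * k) := by ring
    _ ≤ C * N ^ (m + 2) * (1 + z.im ^ 2)⁻¹ * Real.exp (|L| * k) :=
        mul_le_mul_of_nonneg_right (hCle N hN z hz) (Real.exp_pos _).le
    _ = _ := by ring

theorem integrable_splineKernel {m B : ℕ} (hmB : m + 2 ≤ B) {N : ℝ} (hN : 1 ≤ N) (L c : ℝ) :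
    Integrable fun t : ℝ => splineKernel m B N L (c + t * I) := by
  obtain ⟨C, hC⟩ := exists_norm_splineKernel_le hmB hN L |c|
  refine integrable_vertical (differentiable_splineKernel m B N L).continuous (C := C) fun t => ?_
  simpa using hC (c + t * I) (by simp)

theorem integral_splineKernel_eq {m B : ℕ} (hmB : m + 2 ≤ B) {N : ℝ} (hN : 1 ≤ N) (L : ℝ)
    (c c' : ℝ) : ∫ t : ℝ, splineKernel m B N L (c + t * I) =
      ∫ t : ℝ, splineKernel m B N L (c' + t * I) := by
  wlog h : c ≤ c' generalizing c c'
  · exact (this c' c (le_of_not_ge h)).symm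
  obtain ⟨C, hC⟩ := exists_norm_splineKernel_le hmB hN L (max |c| |c'|)
  refine integral_vertical_eq (differentiable_splineKernel m B N L) (C := C) h fun x hx t => ?_
  simpa using hC (x + t * I) (by simpa using abs_le_max_abs_abs hx.1 hx.2)

/-- A Paley–Wiener argument: move the line to `Re z = ±r`, with the sign that makes `exp (L z)`
decay. The factor `exp (B r / N)` from `sinhc` is absorbed by `exp (-|L| r)`, and the four spare
powers of `1 / ‖z‖` leave `O(r⁻²)`. -/
theorem integral_splineKernel_eq_zero {m B : ℕ} (hmB : m + 4 ≤ B) {N : ℝ} (hN : 1 ≤ N) {L : ℝ}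
    (hL : B / N ≤ |L|) (c : ℝ) : ∫ t : ℝ, splineKernel m B N L (c + t * I) = 0 := by
  have hN0 : 0 < N := by linarith
  have key : ∀ r : ℝ, 1 ≤ r →
      ‖∫ t : ℝ, splineKernel m B N L (c + t * I)‖ ≤ N ^ B * Real.pi * (r ^ 2)⁻¹ := by
    intro r hr
    obtain ⟨c', hc', hLc⟩ : ∃ c' : ℝ, |c'| = r ∧ L * c' = -(|L| * r) := by
      rcases le_total 0 L with h | h
      · exact ⟨-r, by rw [abs_neg, abs_of_nonneg (by linarith)], by rw [abs_of_nonneg h]; ring⟩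
      · exact ⟨r, abs_of_nonneg (by linarith), by rw [abs_of_nonpos h]; ring⟩
    rw [integral_splineKernel_eq (by omega) hN L c c']
    refine (norm_integral_vertical_le (C := N ^ B * (r ^ 2)⁻¹) fun t => ?_).trans_eq (by ring)
    set z : ℂ := c' + t * I with hz
    have hzre : z.re = c' := by simp [hz]
    have hzsq : ‖z‖ ^ 2 = r ^ 2 + t ^ 2 := by
      rw [← normSq_eq_norm_sq, hz, normSq_add_mul_I, ← hc', sq_abs]
    have hz1 : 1 ≤ ‖z‖ := by
      rw [← hc', ← hzre] at hr
      exact hr.trans (abs_re_le_norm z)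
    have hz4 : r ^ 2 * (1 + t ^ 2) ≤ ‖z‖ ^ 4 := by
      have : ‖z‖ ^ 4 = (r ^ 2 + t ^ 2) ^ 2 := by rw [← hzsq]; ring
      rw [this]
      have : 1 ≤ r ^ 2 := one_le_pow₀ hr
      nlinarith [sq_nonneg t, sq_nonneg r, mul_nonneg (sq_nonneg r) (sq_nonneg t)]
    have h1 := norm_mul_norm_sinhc_le (z / N)
    rw [norm_div, norm_real, Real.norm_of_nonneg hN0.le, div_ofReal_re, abs_div, abs_of_pos hN0,
      hzre, hc'] at h1
    have h2 : (‖z‖ / N * ‖sinhc (z / N)‖) ^ B ≤ Real.exp (|L| * r) := by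
      refine (pow_le_pow_left₀ (by positivity) h1 B).trans ?_
      rw [← Real.exp_nat_mul, Real.exp_le_exp]
      calc (B : ℝ) * (r / N) = B / N * r := by ring
        _ ≤ _ := by gcongr
    rw [norm_splineKernel, hzre, hLc, Real.exp_neg, mul_assoc (N ^ B), ← mul_inv,
      ← div_eq_mul_inv, ← div_eq_mul_inv, div_le_div_iff₀ (Real.exp_pos _) (by positivity)]
    calc ‖z‖ ^ m * ‖sinhc (z / N)‖ ^ B * (r ^ 2 * (1 + t ^ 2))
        ≤ ‖z‖ ^ m * ‖sinhc (z / N)‖ ^ B * ‖z‖ ^ 4 := by gcongr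
      _ = ‖z‖ ^ (m + 4) * ‖sinhc (z / N)‖ ^ B := by ring
      _ ≤ ‖z‖ ^ B * ‖sinhc (z / N)‖ ^ B := by gcongr
      _ = N ^ B * (‖z‖ / N * ‖sinhc (z / N)‖) ^ B := by
          rw [mul_pow, div_pow]; field_simp
      _ ≤ _ := by gcongr
  have hlim : Tendsto (fun r : ℝ => N ^ B * Real.pi * (r ^ 2)⁻¹) atTop (𝓝 0) := by
    simpa using (tendsto_inv_atTop_zero.comp
      (tendsto_pow_atTop (α := ℝ) two_ne_zero)).const_mul (N ^ B * Real.pi)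
  have := ge_of_tendsto hlim ((eventually_ge_atTop 1).mono key)
  exact norm_le_zero_iff.1 this

/-- On the imaginary axis the kernel is `I ^ m` times `t ^ m sinc (t / N) ^ B`. Evenness of `m` and
`B` makes this nonnegative, so the part over `[0, 1]`, where `sinc ≥ 2 / π`, bounds the integral
below uniformly in `N`. -/
theorem le_norm_integral_splineKernel {m B : ℕ} (hmB : m + 2 ≤ B) (hm : Even m) (hB : Even B)
    {N : ℝ} (hN : 1 ≤ N) (c : ℝ) :
    (2 / Real.pi) ^ B / (m + 1) ≤ ‖∫ t : ℝ, splineKernel m B N 0 (c + t * I)‖ := by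
  have hN0 : 0 < N := by linarith
  have hint := integrable_splineKernel hmB hN 0 0
  rw [integral_splineKernel_eq hmB hN 0 c 0]
  have e : ∀ t : ℝ, splineKernel m B N 0 ((0 : ℝ) + t * I) =
      I ^ m * ((t ^ m * Real.sinc (t / N) ^ B : ℝ) : ℂ) := by
    intro t
    have h1 : ((0 : ℝ) + t * I : ℂ) / N = (t / N : ℝ) * I := by push_cast; ring
    rw [splineKernel, h1, sinhc_mul_I]
    push_cast
    simp only [mul_pow, zero_add, zero_mul, exp_zero, mul_one]
    ring
  simp_rw [e] at hint ⊢
  have hint' : Integrable fun t : ℝ => t ^ m * Real.sinc (t / N) ^ B := by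
    have := (hint.const_mul (I ^ m)⁻¹).re
    refine this.congr (Eventually.of_forall fun t => ?_)
    simp only [inv_mul_cancel_left₀ (pow_ne_zero m I_ne_zero)]
    exact ofReal_re _
  have hnn : ∀ t : ℝ, 0 ≤ t ^ m * Real.sinc (t / N) ^ B := fun t =>
    mul_nonneg (hm.pow_nonneg _) (hB.pow_nonneg _)
  rw [integral_const_mul, integral_complex_ofReal, norm_mul, norm_pow, norm_I, one_pow, one_mul, norm_real]
  refine le_trans ?_ (le_abs_self _)
  calc (2 / Real.pi) ^ B / (m + 1) = ∫ t in (0 : ℝ)..1, t ^ m * (2 / Real.pi) ^ B := by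
        rw [intervalIntegral.integral_mul_const, integral_pow]; simp; field_simp
    _ ≤ ∫ t in (0 : ℝ)..1, t ^ m * Real.sinc (t / N) ^ B := by
        refine intervalIntegral.integral_mono_on zero_le_one
          ((by fun_prop : Continuous fun t : ℝ => t ^ m * (2 / Real.pi) ^ B).intervalIntegrable
          0 1) hint'.intervalIntegrable fun t ht => ?_
        have := two_div_pi_le_sinc (div_nonneg ht.1 hN0.le) ((div_le_self ht.1 hN).trans ht.2)
        have h0 := ht.1
        gcongr
    _ = ∫ t in Set.Ioc (0 : ℝ) 1, t ^ m * Real.sinc (t / N) ^ B :=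
        intervalIntegral.integral_of_le zero_le_one
    _ ≤ _ := setIntegral_le_integral hint' (Eventually.of_forall hnn)

end Complex

/-! ### Decay of coefficients from growth on the left -/

section

open Complex Filter MeasureTheory Topology

theorem Real.inv_two_mul_le_abs_log_sub_log {n j : ℕ} (hn : n ≠ 0) (hj : j ≠ 0) (h : j ≠ n) :
    (2 * n : ℝ)⁻¹ ≤ |Real.log n - Real.log j| := by
  have hn0 : (0 : ℝ) < n := by positivity
  have hj0 : (0 : ℝ) < j := by positivity
  have hn1 : (1 : ℝ) ≤ n := by exact_mod_cast Nat.one_le_iff_ne_zero.2 hn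
  rcases lt_or_gt_of_ne h with h | h
  · have h1 : (j : ℝ) + 1 ≤ n := by exact_mod_cast h
    have h2 := Real.one_sub_inv_le_log_of_pos (div_pos hn0 hj0)
    rw [Real.log_div hn0.ne' hj0.ne', inv_div] at h2
    refine le_trans (le_trans ?_ h2) (le_abs_self _)
    rw [one_sub_div hn0.ne', inv_eq_one_div, div_le_div_iff₀ (by positivity) hn0]
    nlinarith
  · have h1 : (n : ℝ) + 1 ≤ j := by exact_mod_cast h
    have h2 := Real.one_sub_inv_le_log_of_pos (div_pos hj0 hn0)
    rw [Real.log_div hj0.ne' hn0.ne', inv_div] at h2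
    rw [abs_sub_comm]
    refine le_trans (le_trans ?_ h2) (le_abs_self _)
    rw [one_sub_div hj0.ne', inv_eq_one_div, div_le_div_iff₀ (by positivity) hj0]
    nlinarith

theorem LSeries.term_one_add_eq (a : ℕ → ℂ) {j : ℕ} (hj : j ≠ 0) (z : ℂ) :
    LSeries.term a (1 + z) j = a j / j * exp (-(Real.log j : ℂ) * z) := by
  have hj' : (j : ℂ) ≠ 0 := Nat.cast_ne_zero.2 hj
  rw [LSeries.term_of_ne_zero hj, cpow_add _ _ hj', cpow_one, cpow_def_of_ne_zero hj',
    ← natCast_log, neg_mul, exp_neg]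
  field_simp

/-- The coefficients of a Dirichlet series are recovered from its values on `Re s = 2` by
integration against a kernel. -/
theorem integral_mul_LSeries {a : ℕ → ℂ} (ha : LSeriesSummable a 2) {m B n : ℕ} (hmB : m + 4 ≤ B)
    (hn : n ≠ 0) :
    ∫ t : ℝ, splineKernel m B (2 * B * n) (Real.log n) ((1 : ℝ) + t * I) *
        LSeries a (1 + ((1 : ℝ) + t * I)) =
      a n / n * ∫ t : ℝ, splineKernel m B (2 * B * n) 0 ((1 : ℝ) + t * I) := by
  -- This makes `B / N = 1 / (2n)`, the lower bound for `|log n - log j|` with `j ≠ n`. The kernel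
  -- therefore annihilates every term except the `n`-th.
  set N : ℝ := 2 * B * n with hN
  have hB0 : 0 < B := by omega
  have hN1 : 1 ≤ N := by
    rw [hN]; exact_mod_cast Nat.one_le_iff_ne_zero.2 (by positivity)
  have hk : ∀ (L L' : ℝ) (z : ℂ), splineKernel m B N L z * exp (-(L' : ℂ) * z) =
      splineKernel m B N (L - L') z := by
    intro L L' z
    unfold splineKernel
    rw [mul_assoc, ← exp_add]
    congr 2
    push_cast; ring
  have hint := fun L => integrable_splineKernel (m := m) (B := B) (by omega) hN1 L 1
  set G : ℕ → ℝ → ℂ := fun j t => splineKernel m B N (Real.log n) ((1 : ℝ) + t * I) *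
    LSeries.term a (1 + ((1 : ℝ) + t * I)) j with hG
  have hG0 : G 0 = 0 := by ext t; simp [hG]
  have hGj : ∀ j, j ≠ 0 → G j = fun t : ℝ =>
      a j / j * splineKernel m B N (Real.log n - Real.log j) ((1 : ℝ) + t * I) := by
    intro j hj
    ext t
    simp only [hG]
    rw [LSeries.term_one_add_eq a hj, ← hk]
    ring
  have hGint : ∀ j, Integrable (G j) := by
    intro j
    rcases eq_or_ne j 0 with rfl | hj
    · rw [hG0]; exact integrable_zero _ _ _
    · rw [hGj j hj]; exact (hint _).const_mul _
  have hre : ∀ t : ℝ, (1 + ((1 : ℝ) + t * I) : ℂ).re = 2 := fun t => by simp; norm_num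
  have hnorm : ∀ j t, ‖G j t‖ =
      ‖LSeries.term a 2 j‖ * ‖splineKernel m B N (Real.log n) ((1 : ℝ) + t * I)‖ := by
    intro j t
    simp only [hG]
    rw [norm_mul, mul_comm, LSeries.norm_term_eq, LSeries.norm_term_eq, hre]
    simp
  have hsum : Summable fun j => ∫ t, ‖G j t‖ := by
    simp_rw [hnorm, integral_const_mul]
    exact ha.norm.mul_right _
  have h1 := (hasSum_integral_of_summable_integral_norm hGint hsum).tsum_eq
  have h2 : ∀ t : ℝ, ∑' j, G j t = splineKernel m B N (Real.log n) ((1 : ℝ) + t * I) *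
      LSeries a (1 + ((1 : ℝ) + t * I)) := fun t => by
    simp only [hG]
    rw [tsum_mul_left, LSeries]
  simp_rw [h2] at h1
  rw [← h1, tsum_eq_single n, hGj n hn, integral_const_mul, sub_self]
  intro j hjn
  rcases eq_or_ne j 0 with rfl | hj
  · rw [hG0]; simp
  · rw [hGj j hj, integral_const_mul, integral_splineKernel_eq_zero hmB hN1, mul_zero]
    refine le_of_eq_of_le ?_ (Real.inv_two_mul_le_abs_log_sub_log hn hj hjn)
    rw [hN]
    have : (B : ℝ) ≠ 0 := by positivity
    have : (n : ℝ) ≠ 0 := by positivity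
    field_simp

/-- A Dirichlet series such that `z ^ m * LSeries a (1 + z)` continues to an entire function which
grows like `‖z‖ ^ M` in the strip `-κ ≤ Re z ≤ 1` has small coefficients if `κ` is large. -/
theorem exists_norm_coeff_le {a : ℕ → ℂ} (ha : LSeriesSummable a 2) {E : ℂ → ℂ}
    (hE : Differentiable ℂ E) {m M : ℕ} (hm : Even m) {κ C : ℝ} (hκ : 0 ≤ κ)
    (hEa : ∀ z : ℂ, z.re = 1 → E z = z ^ m * LSeries a (1 + z))
    (hEC : ∀ z : ℂ, -κ ≤ z.re → z.re ≤ 1 → ‖E z‖ ≤ C * (1 + ‖z‖) ^ M) :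
    ∃ C' : ℝ, ∀ n : ℕ, n ≠ 0 → ‖a n‖ ≤ C' * (n : ℝ) ^ (M + 3 - κ) := by
  -- Even, and at least both `m + 4` and `M + 2`.
  set B : ℕ := 2 * (m + M + 2) with hB
  have hBeven : Even B := even_two_mul _
  obtain ⟨C₁, hC₁, hS⟩ := exists_norm_sinhc_pow_mul_le (κ + 1) (M := M) (B := B) (by omega)
  have hC0 : 0 ≤ C := by simpa using (norm_nonneg _).trans (hEC 0 (by simpa using hκ) (by simp))
  set c₀ : ℝ := (2 / Real.pi) ^ B / (m + 1) with hc₀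
  have hc₀pos : 0 < c₀ := by positivity
  refine ⟨C * C₁ * (2 * B) ^ (M + 2) * Real.pi / c₀, fun n hn => ?_⟩
  have hn0 : (0 : ℝ) < n := by positivity
  have hn1 : (1 : ℝ) ≤ n := by exact_mod_cast Nat.one_le_iff_ne_zero.2 hn
  set N : ℝ := 2 * B * n with hN
  have hN1 : 1 ≤ N := by
    rw [hN]; exact_mod_cast Nat.one_le_iff_ne_zero.2 (by positivity)
  set f : ℂ → ℂ := fun z => sinhc (z / N) ^ B * exp (Real.log n * z) * E z with hf
  have hfd : Differentiable ℂ f := by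
    have := differentiable_sinhc
    fun_prop
  have hexp : ∀ z : ℂ, ‖exp (Real.log n * z)‖ = (n : ℝ) ^ z.re := fun z => by
    rw [norm_exp, re_ofReal_mul, Real.rpow_def_of_pos hn0]
  have hbound : ∀ z : ℂ, -κ ≤ z.re → z.re ≤ 1 →
      ‖f z‖ ≤ C * C₁ * N ^ (M + 2) * (n : ℝ) ^ z.re * (1 + z.im ^ 2)⁻¹ := by
    intro z h1 h2
    have hz := hS N hN1 z (abs_le.2 ⟨by linarith, by linarith⟩)
    simp only [hf]
    rw [norm_mul, norm_mul, norm_pow, hexp]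
    calc _ ≤ ‖sinhc (z / N)‖ ^ B * (n : ℝ) ^ z.re * (C * (1 + ‖z‖) ^ M) := by
          gcongr; exact hEC z h1 h2
      _ = (‖sinhc (z / N)‖ ^ B * (1 + ‖z‖) ^ M) * ((n : ℝ) ^ z.re * C) := by ring
      _ ≤ C₁ * N ^ (M + 2) * (1 + z.im ^ 2)⁻¹ * ((n : ℝ) ^ z.re * C) :=
          mul_le_mul_of_nonneg_right hz (by positivity)
      _ = _ := by ring
  -- On the left line `n ^ z` gives `n ^ (-κ)` and the kernel costs `N ^ (M + 2)`, with `N`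
  -- proportional to `n`. On the right line the integral is `a n / n` times a quantity bounded
  -- below; this accounts for the exponent `M + 3 - κ`.
  have hshift : ∫ t : ℝ, f ((-κ : ℝ) + t * I) = ∫ t : ℝ, f ((1 : ℝ) + t * I) := by
    refine integral_vertical_eq hfd (by linarith) (C := C * C₁ * N ^ (M + 2) * n) fun x hx t => ?_
    refine (hbound _ (by simpa using hx.1) (by simpa using hx.2)).trans ?_
    have h1 : (n : ℝ) ^ (x + t * I : ℂ).re ≤ n := by
      simpa using Real.rpow_le_rpow_of_exponent_le hn1 hx.2
    have h2 : (x + t * I : ℂ).im = t := by simp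
    rw [h2]
    gcongr
  have hleft : ‖∫ t : ℝ, f ((-κ : ℝ) + t * I)‖ ≤
      C * C₁ * N ^ (M + 2) * (n : ℝ) ^ (-κ) * Real.pi := by
    refine norm_integral_vertical_le fun t => ?_
    have := hbound ((-κ : ℝ) + t * I) (by simp) (by simp; linarith)
    simpa using this
  have hright : ∫ t : ℝ, f ((1 : ℝ) + t * I) =
      a n / n * ∫ t : ℝ, splineKernel m B N 0 ((1 : ℝ) + t * I) := by
    rw [← integral_mul_LSeries ha (by omega) hn]
    refine integral_congr_ae (Eventually.of_forall fun t => ?_)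
    simp only [hf, splineKernel]
    rw [hEa _ (by simp), ← hN]
    ring
  have hlow := le_norm_integral_splineKernel (m := m) (B := B) (by omega) hm hBeven hN1 1
  rw [hshift, hright, norm_mul, norm_div, Complex.norm_natCast] at hleft
  have h1 : ‖a n‖ / n * c₀ ≤ C * C₁ * N ^ (M + 2) * (n : ℝ) ^ (-κ) * Real.pi :=
    le_trans (by gcongr) hleft
  have h2 : (n : ℝ) ^ (M + 3 - κ) = n ^ (M + 2) * n * (n : ℝ) ^ (-κ) := by
    rw [← pow_succ, ← Real.rpow_natCast, ← Real.rpow_add hn0]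
    congr 1; push_cast; ring
  rw [div_mul_eq_mul_div, div_le_iff₀ hn0] at h1
  rw [h2, div_mul_eq_mul_div, le_div_iff₀ hc₀pos]
  refine h1.trans_eq ?_
  rw [hN]; ring

/-- Phragmén–Lindelöf for polynomial bounds on an entire function of finite order in a strip. -/
theorem IsEntireOfFiniteOrder.exists_norm_le {E : ℂ → ℂ} (hE : IsEntireOfFiniteOrder E) {a b C : ℝ}
    {M : ℕ} (hab : a < b) (ha : ∀ z : ℂ, z.re = a → ‖E z‖ ≤ C * (1 + ‖z‖) ^ M)
    (hb : ∀ z : ℂ, z.re = b → ‖E z‖ ≤ C * (1 + ‖z‖) ^ M) :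
    ∃ C' : ℝ, ∀ z : ℂ, a ≤ z.re → z.re ≤ b → ‖E z‖ ≤ C' * (1 + ‖z‖) ^ M := by
  obtain ⟨hEd, ρ, hO⟩ := hE
  -- With this shift `‖z + r‖ ≥ 1` in the strip, so dividing by `(z + r) ^ M` is safe and makes the
  -- boundary values bounded.
  set r : ℝ := 1 - a with hr
  have hC0 : 0 ≤ C := by
    have h1 := (norm_nonneg _).trans (ha a (by simp))
    exact nonneg_of_mul_nonneg_left h1 (by positivity)
  have hre : ∀ z : ℂ, a ≤ z.re → 1 ≤ ‖z + r‖ := fun z hz => by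
    refine le_trans ?_ (re_le_norm _)
    simp [hr]; linarith
  have hup : ∀ z : ℂ, ‖z + r‖ ≤ (1 + |r|) * (1 + ‖z‖) := fun z => by
    refine (norm_add_le _ _).trans ?_
    rw [norm_real, Real.norm_eq_abs]
    nlinarith [norm_nonneg z, abs_nonneg r]
  have hlow : ∀ z : ℂ, a ≤ z.re → 1 + ‖z‖ ≤ (2 + |r|) * ‖z + r‖ := fun z hz => by
    have h1 := hre z hz
    have h2 : ‖z‖ ≤ ‖z + r‖ + |r| := by
      have := norm_sub_le (z + r) (r : ℂ)
      rwa [add_sub_cancel_right, norm_real, Real.norm_eq_abs] at this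
    nlinarith [abs_nonneg r]
  set H : ℂ → ℂ := fun z => E z / (z + r) ^ M with hH
  have hHE : ∀ z : ℂ, a ≤ z.re → ‖H z‖ ≤ ‖E z‖ := fun z hz => by
    simp only [hH]
    rw [norm_div, norm_pow]
    exact div_le_self (norm_nonneg _) (one_le_pow₀ (hre z hz))
  have hbd : ∀ z : ℂ, a ≤ z.re → ‖E z‖ ≤ C * (1 + ‖z‖) ^ M → ‖H z‖ ≤ C * (2 + |r|) ^ M := by
    intro z hz h
    simp only [hH]
    have := hre z hz
    rw [norm_div, norm_pow, div_le_iff₀ (by positivity)]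
    refine h.trans ?_
    rw [mul_assoc, ← mul_pow]
    gcongr
    exact hlow z hz
  have hcl : closure (re ⁻¹' Set.Ioo a b) ⊆ {z : ℂ | a ≤ z.re} :=
    closure_minimal (fun z hz => hz.1.le) (isClosed_le continuous_const continuous_re)
  have hdiff : DiffContOnCl ℂ H (re ⁻¹' Set.Ioo a b) := by
    refine DifferentiableOn.diffContOnCl fun z hz => ?_
    refine (DifferentiableAt.div hEd.differentiableAt (by fun_prop) ?_).differentiableWithinAt
    refine pow_ne_zero _ (norm_pos_iff.1 ?_)
    linarith [hre z (hcl hz)]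
  have hl : comap (abs ∘ im) atTop ≤ cocompact ℂ := by
    rw [← Metric.cobounded_eq_cocompact, ← comap_norm_atTop, ← tendsto_iff_comap]
    exact tendsto_atTop_mono abs_im_le_norm tendsto_comap
  have hgrowth : ∃ c < Real.pi / (b - a), ∃ B, H =O[comap (abs ∘ im) atTop ⊓ 𝓟 (re ⁻¹' Set.Ioo a b)]
      fun z => Real.exp (B * Real.exp (c * |z.im|)) := by
    have hc0 : 0 < Real.pi / (b - a) := div_pos Real.pi_pos (sub_pos.2 hab)
    -- Any positive number below the critical rate `π / (b - a)` would do, since a power of `‖z‖` is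
    -- dominated by `exp (c ‖z‖)`.
    set c := Real.pi / (b - a) / 2 with hc
    have hcpos : 0 < c := half_pos hc0
    set n := ⌈ρ⌉₊ with hn
    set K := max |a| |b| with hK
    set B := n.factorial / c ^ n * Real.exp (c * K) with hB
    refine ⟨c, half_lt_self hc0, B, ?_⟩
    have h1 : H =O[comap (abs ∘ im) atTop ⊓ 𝓟 (re ⁻¹' Set.Ioo a b)] E :=
      Asymptotics.IsBigO.of_bound 1 (eventually_inf_principal.2 (Eventually.of_forall
        fun z hz => by rw [one_mul]; exact hHE z hz.1.le))
    refine (h1.trans (hO.mono (inf_le_left.trans hl))).trans ?_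
    refine Asymptotics.IsBigO.of_bound 1 (eventually_inf_principal.2 ?_)
    have hge : ∀ᶠ z : ℂ in comap (abs ∘ im) atTop, 1 ≤ |z.im| :=
      tendsto_comap.eventually (eventually_ge_atTop 1)
    filter_upwards [hge] with z hz1 hz
    rw [one_mul, Real.norm_of_nonneg (Real.exp_pos _).le, Real.norm_of_nonneg (Real.exp_pos _).le,
      Real.exp_le_exp]
    have hz2 : 1 ≤ ‖z‖ := hz1.trans (abs_im_le_norm z)
    have hz3 : ‖z‖ ≤ K + |z.im| := (norm_le_abs_re_add_abs_im z).trans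
      (by gcongr; exact abs_le_max_abs_abs hz.1.le hz.2.le)
    have h2 : ‖z‖ ^ ρ ≤ ‖z‖ ^ n := by
      rw [← Real.rpow_natCast]
      exact Real.rpow_le_rpow_of_exponent_le hz2 (Nat.le_ceil ρ)
    have h3 := Real.pow_div_factorial_le_exp (c * ‖z‖) (by positivity) n
    have h4 : Real.exp (c * ‖z‖) ≤ Real.exp (c * K) * Real.exp (c * |z.im|) := by
      rw [← Real.exp_add, Real.exp_le_exp, ← mul_add]
      gcongr
    rw [mul_pow, div_le_iff₀ (by positivity)] at h3
    calc ‖z‖ ^ ρ ≤ ‖z‖ ^ n := h2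
      _ ≤ n.factorial / c ^ n * (Real.exp (c * K) * Real.exp (c * |z.im|)) := by
          rw [div_mul_eq_mul_div, le_div_iff₀ (by positivity)]
          nlinarith [mul_le_mul_of_nonneg_right h4 (Nat.cast_nonneg (α := ℝ) n.factorial)]
      _ = _ := by rw [hB]; ring
  refine ⟨C * (2 + |r|) ^ M * (1 + |r|) ^ M, fun z hza hzb => ?_⟩
  have hPL := PhragmenLindelof.vertical_strip hdiff hgrowth
    (fun z hz => hbd z hz.ge (ha z hz)) (fun z hz => hbd z (hz ▸ hab.le) (hb z hz)) hza hzb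
  have h1 := hre z hza
  have h2 : ‖E z‖ = ‖H z‖ * ‖z + r‖ ^ M := by
    simp only [hH]
    rw [norm_div, norm_pow, div_mul_cancel₀]
    positivity
  rw [h2, mul_assoc, ← mul_pow]
  gcongr
  exact hup z

namespace SelbergAxioms

variable {F : ℂ → ℂ} {a : ℕ → ℂ}

theorem exists_norm_le (h : SelbergAxioms F a) {σ : ℝ} (hσ : 1 < σ) :
    ∃ C : ℝ, ∀ t : ℝ, ‖F (σ + t * I)‖ ≤ C := by
  refine ⟨∑' n, ‖LSeries.term a σ n‖, fun t => ?_⟩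
  have hs : 1 < (σ + t * I : ℂ).re := by simpa using hσ
  rw [h.eq_LSeries hs]
  refine (norm_tsum_le_tsum_norm (h.lseriesSummable hs).norm).trans_eq ?_
  refine tsum_congr fun n => ?_
  rw [LSeries.norm_term_eq, LSeries.norm_term_eq]; simp

/-- On a line far to the left, a function in the Selberg class grows polynomially, with an exponent
controlled by the degree. -/
theorem exists_norm_mul_le (h : SelbergAxioms F a) {g : GammaFactor} (hg : g.Admissible F)
    {m : ℕ} {E : ℂ → ℂ} (hE : Differentiable ℂ E) (hEF : ∀ s : ℂ, s ≠ 1 → E s = (s - 1) ^ m * F s)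
    {σ : ℝ} (hσ : 1 < σ) {M : ℕ} (hM : m + (σ - 1 / 2) * g.degree + g.k ≤ M) :
    ∃ C : ℝ, ∀ s : ℂ, s.re = 1 - σ → ‖E s‖ ≤ C * (1 + ‖s‖) ^ M := by
  obtain ⟨C₁, hC₁, hev⟩ := hg.exists_norm_le hσ.le
  obtain ⟨C₂, hC₂⟩ := h.exists_norm_le hσ
  obtain ⟨T, hT⟩ := eventually_atTop.1 hev
  obtain ⟨D, hD⟩ := (isCompact_closedBall (0 : ℂ) (|1 - σ| + max T 1)).exists_bound_of_continuousOn
    hE.continuous.continuousOn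
  have hC₂0 : 0 ≤ C₂ := (norm_nonneg _).trans (hC₂ 0)
  refine ⟨max D (2 ^ m * (C₁ * C₂)), fun s hs => ?_⟩
  have hs1 : (1 : ℝ) ≤ (1 + ‖s‖) ^ M := one_le_pow₀ (by linarith [norm_nonneg s])
  rcases le_or_gt |s.im| (max T 1) with ht | ht
  · have h1 : ‖s‖ ≤ |1 - σ| + max T 1 := by
      rw [← hs]; exact (norm_le_abs_re_add_abs_im s).trans (by gcongr)
    have h2 := hD s (by simpa using h1)
    have h3 : 0 ≤ D := (norm_nonneg _).trans h2
    calc ‖E s‖ ≤ D := h2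
      _ ≤ D * (1 + ‖s‖) ^ M := le_mul_of_one_le_right h3 hs1
      _ ≤ _ := by gcongr; exact le_max_left _ _
  · have hne : s ≠ 1 := fun h => by
      rw [h, one_im, abs_zero] at ht
      linarith [le_max_right T 1]
    have ht1 : 1 ≤ |s.im| := (le_max_right T 1).trans ht.le
    have hse : s = ((1 - σ : ℝ) : ℂ) + (s.im : ℂ) * I := by rw [← hs]; exact (re_add_im s).symm
    have h1 := hT |s.im| ((le_max_left T 1).trans ht.le) s.im rfl
    rw [← hse] at h1
    have h2 : ‖s - 1‖ ≤ 2 * (1 + ‖s‖) := by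
      refine (norm_sub_le _ _).trans ?_
      rw [norm_one]; linarith [norm_nonneg s]
    have he0 : 0 ≤ (σ - 1 / 2) * g.degree + g.k :=
      add_nonneg (mul_nonneg (by linarith) g.degree_nonneg) (Nat.cast_nonneg _)
    have h3 : |s.im| ^ ((σ - 1 / 2) * g.degree + g.k) ≤
        (1 + ‖s‖) ^ ((σ - 1 / 2) * g.degree + g.k) := by
      refine Real.rpow_le_rpow (abs_nonneg _) ?_ he0
      linarith [abs_im_le_norm s]
    have h4 : (1 + ‖s‖) ^ m * (1 + ‖s‖) ^ ((σ - 1 / 2) * g.degree + g.k) ≤ (1 + ‖s‖) ^ M := by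
      rw [← Real.rpow_natCast, ← Real.rpow_natCast, ← Real.rpow_add (by positivity)]
      refine Real.rpow_le_rpow_of_exponent_le (by linarith [norm_nonneg s]) (by linarith)
    rw [hEF s hne, norm_mul, norm_pow]
    calc ‖s - 1‖ ^ m * ‖F s‖ ≤ (2 * (1 + ‖s‖)) ^ m *
          (C₁ * (1 + ‖s‖) ^ ((σ - 1 / 2) * g.degree + g.k) * C₂) := by
          gcongr
          exact h1.trans (by gcongr; exact hC₂ s.im)
      _ = 2 ^ m * (C₁ * C₂) *
          ((1 + ‖s‖) ^ m * (1 + ‖s‖) ^ ((σ - 1 / 2) * g.degree + g.k)) := by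
          rw [mul_pow]; ring
      _ ≤ 2 ^ m * (C₁ * C₂) * (1 + ‖s‖) ^ M := by gcongr
      _ ≤ _ := by gcongr; exact le_max_right _ _

/-- If the degree is less than `1`, the coefficients decay rapidly. -/
theorem exists_norm_coeff_le (h : SelbergAxioms F a) {g : GammaFactor} (hg : g.Admissible F)
    (hd : g.degree < 1) (A : ℝ) : ∃ C : ℝ, 0 ≤ C ∧ ∀ n : ℕ, n ≠ 0 → ‖a n‖ ≤ C * (n : ℝ) ^ (-A) := by
  obtain ⟨m, E, hE, hEF⟩ := h.analyticity
  -- The final exponent is `(M + m) + 3 - σ` with `M ≤ m + (σ - 1/2) d + k + 1`, hence at most `2m +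
  -- k + 4 - σ (1 - d) ≤ -A`. This is where `d < 1` enters.
  set σ : ℝ := max 2 ((A + m + m + g.k + 4) / (1 - g.degree)) with hσ
  have hσ2 : 2 ≤ σ := le_max_left _ _
  have hσA : A + m + m + g.k + 4 ≤ σ * (1 - g.degree) := by
    rw [← div_le_iff₀ (sub_pos.2 hd)]; exact le_max_right _ _
  have he0 : 0 ≤ (m : ℝ) + (σ - 1 / 2) * g.degree + g.k :=
    add_nonneg (add_nonneg (Nat.cast_nonneg _) (mul_nonneg (by linarith) g.degree_nonneg))
      (Nat.cast_nonneg _)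
  set M := ⌈(m : ℝ) + (σ - 1 / 2) * g.degree + g.k⌉₊ with hM
  have hM1 := Nat.le_ceil ((m : ℝ) + (σ - 1 / 2) * g.degree + g.k)
  have hM2 := (Nat.ceil_lt_add_one he0).le
  have hmM : m ≤ M := by
    have : (m : ℝ) ≤ M := le_trans (by
      have := mul_nonneg (by linarith : 0 ≤ σ - 1 / 2) g.degree_nonneg
      have := Nat.cast_nonneg (α := ℝ) g.k
      linarith) hM1
    exact_mod_cast this
  obtain ⟨C₁, hC₁⟩ := h.exists_norm_mul_le hg hE.1 hEF (by linarith) hM1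
  obtain ⟨C₂, hC₂⟩ := h.exists_norm_le one_lt_two
  have hC₂0 : 0 ≤ C₂ := (norm_nonneg _).trans (hC₂ 0)
  have hright : ∀ s : ℂ, s.re = 2 → ‖E s‖ ≤ 2 ^ m * C₂ * (1 + ‖s‖) ^ M := by
    intro s hs
    have hne : s ≠ 1 := fun h => by rw [h] at hs; norm_num at hs
    have h2 : ‖s - 1‖ ≤ 2 * (1 + ‖s‖) := by
      refine (norm_sub_le _ _).trans ?_
      rw [norm_one]; linarith [norm_nonneg s]
    have hse : ‖F s‖ ≤ C₂ := by
      have := hC₂ s.im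
      have e : ((2 : ℝ) : ℂ) + (s.im : ℂ) * I = s := by rw [← hs]; exact re_add_im s
      rwa [e] at this
    rw [hEF s hne, norm_mul, norm_pow]
    calc _ ≤ (2 * (1 + ‖s‖)) ^ m * C₂ := by gcongr
      _ = 2 ^ m * C₂ * (1 + ‖s‖) ^ m := by rw [mul_pow]; ring
      _ ≤ _ := by gcongr; linarith [norm_nonneg s]
  obtain ⟨C, hC⟩ := hE.exists_norm_le (a := 1 - σ) (b := 2) (M := M) (C := max C₁ (2 ^ m * C₂))
    (by linarith)
    (fun s hs => (hC₁ s hs).trans (by gcongr; exact le_max_left _ _))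
    (fun s hs => (hright s hs).trans (by gcongr; exact le_max_right _ _))
  have hC0 : 0 ≤ C := by
    have h1 := (norm_nonneg _).trans (hC 1 (by simp; linarith) (by simp))
    exact nonneg_of_mul_nonneg_left h1 (by positivity)
  -- The factor `z ^ m` in `E (1 + z)` removes the pole; a second one makes the total power `m + m`
  -- even, as positivity of the kernel requires.
  obtain ⟨C', hC'⟩ := _root_.exists_norm_coeff_le (h.lseriesSummable (by simp))
    (E := fun z => z ^ m * E (1 + z)) (m := m + m) (M := M + m) (κ := σ) (C := 2 ^ M * C)
    (by have := hE.1; fun_prop) (Even.add_self m) (by linarith)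
    (fun z hz => by
      have hne : 1 + z ≠ 1 := fun h0 => by
        have : z = 0 := by simpa using h0
        rw [this] at hz; simp at hz
      rw [hEF _ hne, h.eq_LSeries (by simp [hz]), add_sub_cancel_left]
      ring)
    (fun z h1 h2 => by
      have h3 := hC (1 + z) (by simp; linarith) (by simp; linarith)
      have h4 : ‖1 + z‖ ≤ 1 + ‖z‖ := (norm_add_le _ _).trans (by simp)
      have h5 : 1 + ‖1 + z‖ ≤ 2 * (1 + ‖z‖) := by linarith [norm_nonneg z]
      rw [norm_mul, norm_pow]
      calc ‖z‖ ^ m * ‖E (1 + z)‖ ≤ (1 + ‖z‖) ^ m * (C * (2 * (1 + ‖z‖)) ^ M) := by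
            gcongr
            · linarith
            · exact h3.trans (by gcongr)
        _ = _ := by rw [mul_pow]; ring)
  refine ⟨|C'|, abs_nonneg _, fun n hn => (hC' n hn).trans ?_⟩
  have hn1 : (1 : ℝ) ≤ n := by exact_mod_cast Nat.one_le_iff_ne_zero.2 hn
  refine mul_le_mul (le_abs_self _) (Real.rpow_le_rpow_of_exponent_le hn1 ?_) (by positivity)
    (abs_nonneg _)
  push_cast
  have := g.degree_nonneg
  nlinarith

end SelbergAxioms

end

/-! ### Coefficients of the logarithm -/

open scoped LSeries.notation in
open Complex Filter Topology in
/-- The coefficients of `LSeries a` and of its logarithm `LSeries b` are related by logarithmic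
differentiation. -/
theorem LSeries.logMul_eq_convolution_of_eq_exp {a b : ℕ → ℂ} {x : ℝ}
    (ha : abscissaOfAbsConv a ≤ x) (hb : abscissaOfAbsConv b ≤ x)
    (h : ∀ s : ℂ, x < s.re → LSeries a s = exp (LSeries b s)) {n : ℕ} (hn : n ≠ 0) :
    logMul a n = (a ⍟ logMul b) n := by
  have hxt : (x : EReal) < ⊤ := EReal.coe_lt_top x
  refine LSeries.eq_of_LSeries_eventually_eq ?_ ?_ ?_ hn
  · rw [abscissaOfAbsConv_logMul]; exact ha.trans_lt hxt
  · refine (abscissaOfAbsConv_convolution_le _ _).trans_lt (max_lt (ha.trans_lt hxt) ?_)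
    rw [abscissaOfAbsConv_logMul]; exact hb.trans_lt hxt
  · filter_upwards [eventually_gt_atTop x] with s hs
    have has : abscissaOfAbsConv a < (s : ℂ).re := ha.trans_lt (by simpa using hs)
    have hbs : abscissaOfAbsConv b < (s : ℂ).re := hb.trans_lt (by simpa using hs)
    rw [LSeries_convolution has (by rwa [abscissaOfAbsConv_logMul])]
    have h1 := LSeries_hasDerivAt has
    have h2 := (LSeries_hasDerivAt hbs).cexp
    have hev : LSeries a =ᶠ[𝓝 (s : ℂ)] fun z => exp (LSeries b z) := by
      filter_upwards [(isOpen_lt continuous_const continuous_re).mem_nhds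
        (show x < (s : ℂ).re by simpa using hs)] with z hz using h z hz
    have h3 := h1.unique (h2.congr_of_eventuallyEq hev)
    rw [← h s (by simpa using hs)] at h3
    linear_combination -h3

open scoped LSeries.notation in
/-- If the `a n` decay like `n⁻²`, then so do the coefficients at `p ^ k`, for fixed `k`, of the
logarithm of `LSeries a`. -/
theorem exists_norm_log_coeff_prime_pow_le {a b : ℕ → ℂ} {C : ℝ} (hC : 0 ≤ C)
    (ha : ∀ n : ℕ, n ≠ 0 → ‖a n‖ ≤ C * ((n : ℝ) ^ 2)⁻¹) (ha1 : a 1 = 1) (hb1 : b 1 = 0)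
    (hab : ∀ n : ℕ, n ≠ 0 → LSeries.logMul a n = (a ⍟ LSeries.logMul b) n) (k : ℕ) :
    ∃ D : ℝ, 0 ≤ D ∧ ∀ p : ℕ, p.Prime → ‖b (p ^ k)‖ ≤ D * ((p : ℝ) ^ 2)⁻¹ := by
  have hapow : ∀ p : ℕ, p.Prime → ∀ j, j ≠ 0 → ‖a (p ^ j)‖ ≤ C * ((p : ℝ) ^ 2)⁻¹ := by
    intro p hp j hj
    have hp0 : (0 : ℝ) < p := by exact_mod_cast hp.pos
    refine (ha _ (pow_ne_zero _ hp.ne_zero)).trans ?_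
    gcongr
    exact_mod_cast Nat.le_self_pow hj p
  induction k using Nat.strong_induction_on with
  | _ k ih =>
    rcases eq_or_ne k 0 with rfl | hk
    · exact ⟨0, le_rfl, fun p _ => by simp [hb1]⟩
    choose! D hD0 hD using ih
    have hD0' : ∀ j ∈ Finset.range k, 0 ≤ C * D j := fun j hj =>
      mul_nonneg hC (hD0 j (Finset.mem_range.1 hj))
    refine ⟨C + ∑ j ∈ Finset.range k, C * D j, add_nonneg hC (Finset.sum_nonneg hD0'),
      fun p hp => ?_⟩
    have hp0 : (0 : ℝ) < p := by exact_mod_cast hp.pos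
    have hp1 : (1 : ℝ) < p := by exact_mod_cast hp.one_lt
    have hlog : 0 < Real.log p := Real.log_pos hp1
    have hk0 : (0 : ℝ) < k := by positivity
    have hlp : ∀ j : ℕ, Complex.log ((p ^ j : ℕ) : ℂ) = ((j * Real.log p : ℝ) : ℂ) := fun j => by
      rw [← Complex.natCast_log]; push_cast; rw [Real.log_pow]; push_cast; ring
    have h := hab (p ^ k) (pow_ne_zero _ hp.ne_zero)
    rw [LSeries.convolution_def] at h
    simp only [LSeries.logMul] at h
    rw [Nat.sum_divisorsAntidiagonal' (f := fun i j => a i * (Complex.log j * b j)),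
      Nat.sum_divisors_prime_pow hp, Finset.sum_range_succ, Nat.div_self (pow_pos hp.pos k), ha1,
      one_mul, hlp] at h
    -- As `a 1 = 1`, the term with `j = k` is `k log p * b (p ^ k)`. Every other term contains some
    -- `a (p ^ (k - j))` with `k - j ≥ 1`, which supplies the decay `p⁻²`.
    have h1 : ‖((k * Real.log p : ℝ) : ℂ) * b (p ^ k)‖ ≤ k * Real.log p *
        ((C + ∑ j ∈ Finset.range k, C * D j) * ((p : ℝ) ^ 2)⁻¹) := by
      rw [← sub_eq_iff_eq_add'.2 h]
      refine (norm_sub_le _ _).trans ?_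
      rw [add_mul, mul_add, Finset.sum_mul, Finset.mul_sum]
      refine add_le_add ?_ ((norm_sum_le _ _).trans (Finset.sum_le_sum fun j hj => ?_))
      · rw [norm_mul, Complex.norm_real, Real.norm_of_nonneg (by positivity)]
        gcongr
        exact hapow p hp k hk
      · have hjk := Finset.mem_range.1 hj
        rw [Nat.pow_div hjk.le hp.pos, hlp, norm_mul, norm_mul, Complex.norm_real,
          Real.norm_of_nonneg (by positivity)]
        have h2 := hapow p hp (k - j) (by omega)
        have h3 : ‖b (p ^ j)‖ ≤ D j := (hD j hjk p hp).trans
          (mul_le_of_le_one_right (hD0 j hjk) (inv_le_one_of_one_le₀ (one_le_pow₀ hp1.le)))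
        calc _ ≤ C * ((p : ℝ) ^ 2)⁻¹ * (k * Real.log p * D j) := by gcongr
          _ = _ := by ring
    rw [norm_mul, Complex.norm_real, Real.norm_of_nonneg (by positivity)] at h1
    exact le_of_mul_le_mul_left h1 (by positivity)

/-- Prime powers are parametrized by pairs `(p, k) ↦ p ^ (k + 1)`, and the bound is a product of two
convergent series. -/
theorem summable_of_norm_prime_pow_le {E : Type*} [NormedAddCommGroup E] [CompleteSpace E]
    {f : ℕ → E} (hf : ∀ n : ℕ, ¬ IsPrimePow n → f n = 0) {A r : ℝ} (hA : 0 ≤ A) (hr0 : 0 ≤ r)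
    (hr1 : r < 1) (h : ∀ p : ℕ, p.Prime → ∀ j : ℕ, ‖f (p ^ j)‖ ≤ A * ((p : ℝ) ^ 2)⁻¹ * r ^ j) :
    Summable f := by
  have h1 : Summable fun p : Nat.Primes => A * (((p : ℕ) : ℝ) ^ 2)⁻¹ :=
    ((Real.summable_nat_pow_inv.2 one_lt_two).comp_injective
      Nat.Primes.coe_nat_injective).mul_left A
  have h2 : Summable fun k : ℕ => r ^ (k + 1) :=
    (summable_nat_add_iff 1).2 (summable_geometric_of_lt_one hr0 hr1)
  have hsum := h1.mul_of_nonneg h2 (fun p => by positivity) (fun k => by positivity)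
  have hsub : Summable (f ∘ ((↑) : {n : ℕ // IsPrimePow n} → ℕ)) := by
    rw [← Equiv.summable_iff Nat.Primes.prodNatEquiv]
    apply Summable.of_norm_bounded hsum
    rintro ⟨p, k⟩
    rw [Function.comp_apply, Function.comp_apply, Nat.Primes.coe_prodNatEquiv_apply]
    exact h p p.2 (k + 1)
  have hind := (summable_subtype_iff_indicator (s := {n : ℕ | IsPrimePow n})).1 hsub
  apply hind.congr
  intro n
  by_cases hn : IsPrimePow n
  · rw [Set.indicator_of_mem (show n ∈ {n | IsPrimePow n} from hn)]
  · rw [Set.indicator_of_notMem (show n ∉ {n | IsPrimePow n} from hn), hf n hn]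

/-- A criterion for absolute convergence at `1 / 2` of a Dirichlet series supported on prime
powers. -/
theorem LSeriesSummable_half_of_prime_pow_bounds {b : ℕ → ℂ} {θ C : ℝ} (hθ : θ < 1 / 2)
    (hb : ∀ n : ℕ, ¬ IsPrimePow n → b n = 0) (hbθ : ∀ n : ℕ, n ≠ 0 → ‖b n‖ ≤ C * (n : ℝ) ^ θ)
    (hbk : ∀ k : ℕ, ∃ D : ℝ, 0 ≤ D ∧ ∀ p : ℕ, p.Prime → ‖b (p ^ k)‖ ≤ D * ((p : ℝ) ^ 2)⁻¹) :
    LSeriesSummable b (1 / 2 : ℝ) := by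
  choose D hD0 hD using hbk
  have hC0 : 0 ≤ C := by simpa using (norm_nonneg _).trans (hbθ 1 one_ne_zero)
  set η : ℝ := 1 / 2 - θ with hη
  have hη0 : 0 < η := sub_pos.2 hθ
  -- The hypothesis on `θ` gives `|b (p ^ j)| p ^ (-j / 2) ≤ C p ^ (-η j)`. For `j ≥ K` the first
  -- `K` factors yield `p⁻²` and the rest are at most `r = 2 ^ (-η)` each. For the finitely many `j
  -- < K` the bounds `D j` apply, with `(r ^ K)⁻¹` in `A` compensating `r ^ j`.
  set K : ℕ := ⌈2 / η⌉₊ with hK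
  have hKη : 2 ≤ K * η := by rw [← div_le_iff₀ hη0]; exact Nat.le_ceil _
  set r : ℝ := (2 : ℝ) ^ (-η) with hr
  have hr0 : 0 < r := by positivity
  have hr1 : r < 1 := Real.rpow_lt_one_of_one_lt_of_neg one_lt_two (neg_lt_zero.2 hη0)
  set A : ℝ := (C + ∑ j ∈ Finset.range K, D j) * (r ^ K)⁻¹ with hA
  have hS0 : 0 ≤ ∑ j ∈ Finset.range K, D j := Finset.sum_nonneg fun j _ => hD0 j
  have key : ∀ p : ℕ, p.Prime → ∀ j : ℕ,
      ‖LSeries.term b (1 / 2 : ℝ) (p ^ j)‖ ≤ A * ((p : ℝ) ^ 2)⁻¹ * r ^ j := by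
    intro p hp j
    have hp0 : (0 : ℝ) < p := by exact_mod_cast hp.pos
    have hp1 : (1 : ℝ) < p := by exact_mod_cast hp.one_lt
    have hp2 : (2 : ℝ) ≤ p := by exact_mod_cast hp.two_le
    have hpj : p ^ j ≠ 0 := pow_ne_zero _ hp.ne_zero
    have hpj0 : (0 : ℝ) < (p ^ j : ℕ) := by positivity
    rw [LSeries.norm_term_eq, if_neg hpj, Complex.ofReal_re]
    rcases lt_or_ge j K with hj | hj
    · have h1 : (1 : ℝ) ≤ ((p ^ j : ℕ) : ℝ) ^ (1 / 2 : ℝ) :=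
        Real.one_le_rpow (by exact_mod_cast Nat.one_le_iff_ne_zero.2 hpj) (by norm_num)
      have h2 : D j ≤ C + ∑ j ∈ Finset.range K, D j :=
        (Finset.single_le_sum (fun j _ => hD0 j) (Finset.mem_range.2 hj)).trans (by linarith)
      have h3 : 1 ≤ (r ^ K)⁻¹ * r ^ j := by
        rw [inv_mul_eq_div, one_le_div (by positivity)]
        exact pow_le_pow_of_le_one hr0.le hr1.le hj.le
      calc _ ≤ ‖b (p ^ j)‖ := div_le_self (norm_nonneg _) h1
        _ ≤ D j * ((p : ℝ) ^ 2)⁻¹ := hD j p hp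
        _ ≤ (C + ∑ j ∈ Finset.range K, D j) * ((p : ℝ) ^ 2)⁻¹ * ((r ^ K)⁻¹ * r ^ j) := by
            refine le_trans ?_ (le_mul_of_one_le_right (by positivity) h3)
            gcongr
        _ = _ := by rw [hA]; ring
    · have h1 : ‖b (p ^ j)‖ / ((p ^ j : ℕ) : ℝ) ^ (1 / 2 : ℝ) ≤ C * ((p : ℝ) ^ (-η)) ^ j := by
        rw [div_le_iff₀ (by positivity)]
        refine (hbθ _ hpj).trans_eq ?_
        rw [← Real.rpow_mul_natCast hp0.le, mul_comm (-η), Real.rpow_natCast_mul hp0.le,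
          ← Nat.cast_pow, mul_assoc, ← Real.rpow_add hpj0]
        congr 2
        rw [hη]; ring
      have h2 : (p : ℝ) ^ (-η) ≤ r :=
        Real.rpow_le_rpow_of_nonpos two_pos hp2 (neg_nonpos.2 hη0.le)
      have h3 : ((p : ℝ) ^ (-η)) ^ K ≤ ((p : ℝ) ^ 2)⁻¹ := by
        rw [← Real.rpow_mul_natCast hp0.le, ← Real.rpow_natCast, ← Real.rpow_neg hp0.le]
        refine Real.rpow_le_rpow_of_exponent_le hp1.le ?_
        push_cast; linarith
      obtain ⟨i, rfl⟩ := Nat.exists_eq_add_of_le hj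
      refine h1.trans ?_
      rw [pow_add, pow_add, hA]
      calc _ ≤ C * (((p : ℝ) ^ 2)⁻¹ * r ^ i) := by gcongr
        _ ≤ (C + ∑ j ∈ Finset.range K, D j) * (((p : ℝ) ^ 2)⁻¹ * r ^ i) := by
            gcongr; linarith
        _ = _ := by field_simp
  refine summable_of_norm_prime_pow_le (fun n hn => ?_) (by positivity) hr0.le hr1 key
  rw [LSeries.term_def, hb n hn]
  simp

/-! ### Triviality in degree less than one -/

namespace SelbergAxioms

open Complex Filter Topology

variable {F : ℂ → ℂ} {a : ℕ → ℂ}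

theorem abscissaOfAbsConv_eq_bot (h : SelbergAxioms F a) {g : GammaFactor} (hg : g.Admissible F)
    (hd : g.degree < 1) : LSeries.abscissaOfAbsConv a = ⊥ := by
  refine EReal.eq_bot_iff_forall_lt _ |>.2 fun y => ?_
  obtain ⟨C, -, hC⟩ := h.exists_norm_coeff_le hg hd (2 - y)
  have := LSeries.abscissaOfAbsConv_le_of_le_const_mul_rpow ⟨C, hC⟩
  refine this.trans_lt ?_
  exact_mod_cast (by linarith : -(2 - y) + 1 < y)

theorem summable_of_degree_lt_one (h : SelbergAxioms F a) {g : GammaFactor} (hg : g.Admissible F)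
    (hd : g.degree < 1) (s : ℂ) : LSeriesSummable a s := by
  refine LSeriesSummable_of_abscissaOfAbsConv_lt_re ?_
  rw [h.abscissaOfAbsConv_eq_bot hg hd]
  exact EReal.bot_lt_coe _

theorem differentiable_LSeries (h : SelbergAxioms F a) {g : GammaFactor} (hg : g.Admissible F)
    (hd : g.degree < 1) : Differentiable ℂ (LSeries a) := by
  have := LSeries_differentiableOn a
  rw [h.abscissaOfAbsConv_eq_bot hg hd] at this
  refine differentiableOn_univ.1 (this.mono fun s _ => ?_)
  exact EReal.bot_lt_coe _

/-- The identity theorem, applied after clearing the possible pole at `1`. -/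
theorem eq_LSeries_of_degree_lt_one (h : SelbergAxioms F a) {g : GammaFactor}
    (hg : g.Admissible F) (hd : g.degree < 1) {s : ℂ} (hs : s ≠ 1) : F s = LSeries a s := by
  obtain ⟨m, E, hE, hEF⟩ := h.analyticity
  have hG := h.differentiable_LSeries hg hd
  have hG' : Differentiable ℂ fun s => (s - 1) ^ m * LSeries a s := by fun_prop
  have hev : E =ᶠ[𝓝 2] fun s => (s - 1) ^ m * LSeries a s := by
    filter_upwards [(isOpen_lt continuous_const continuous_re).mem_nhds
      (show 1 < (2 : ℂ).re by norm_num)] with z hz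
    have hz : 1 < z.re := hz
    rw [hEF z (fun h => by rw [h] at hz; simp at hz), h.eq_LSeries hz]
  have heq := AnalyticOnNhd.eq_of_eventuallyEq (fun z _ => hE.1.analyticAt z)
    (fun z _ => hG'.analyticAt z) hev
  have h1 := (hEF s hs).symm.trans (congrFun heq s)
  exact mul_left_cancel₀ (pow_ne_zero _ (sub_ne_zero.2 hs)) h1

/-- A function in the Selberg class of degree less than `1` has degree `0`. -/
theorem k_eq_zero_of_degree_lt_one (h : SelbergAxioms F a) {g : GammaFactor}
    (hg : g.Admissible F) (hd : g.degree < 1) : g.k = 0 := by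
  by_contra hk
  have hdpos : 0 < g.degree := by
    have : Nonempty (Fin g.k) := ⟨⟨0, Nat.pos_of_ne_zero hk⟩⟩
    exact mul_pos two_pos (Finset.sum_pos (fun i _ => g.w_pos i) Finset.univ_nonempty)
  have hlim : Tendsto (fun σ : ℝ => (σ - 1 / 2) * g.degree) atTop atTop :=
    (tendsto_atTop_add_const_right _ _ tendsto_id).atTop_mul_const hdpos
  -- If `(σ - 1/2) d > k`, then `|F((1 - σ) + it)|` grows like a positive power of `t`, yet the
  -- everywhere absolutely convergent series is bounded on that line.
  obtain ⟨σ, ⟨c, hc, hev⟩, hσ, hσ1⟩ := (hg.exists_le_norm.and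
    ((hlim.eventually_gt_atTop (g.k : ℝ)).and (eventually_gt_atTop 1))).exists
  obtain ⟨c', hc', hlow⟩ := h.exists_le_norm hσ1
  refine absurd (Real.le_of_eventually_mul_rpow_le (e' := 0) (mul_pos hc hc')
    (C := ∑' n, ‖LSeries.term a (1 - σ : ℝ) n‖) ?_) (not_le.2 (sub_pos.2 hσ))
  filter_upwards [hev, eventually_gt_atTop 0] with x hx hx0
  have h1 := hx x (abs_of_pos hx0)
  rw [abs_of_pos hx0] at h1
  rw [Real.rpow_zero, mul_one, mul_right_comm]
  refine (mul_le_mul_of_nonneg_left (hlow x) (by positivity)).trans (h1.trans ?_)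
  rw [h.eq_LSeries_of_degree_lt_one hg hd
    (fun h => hx0.ne' (by simpa [-ofReal_sub] using congrArg im h))]
  refine (norm_tsum_le_tsum_norm (h.summable_of_degree_lt_one hg hd _).norm).trans_eq ?_
  refine tsum_congr fun n => ?_
  rw [LSeries.norm_term_eq, LSeries.norm_term_eq]; simp

/-- The functional equation in degree `0`, for absolute values. -/
theorem norm_LSeries_mul_rpow_eq (h : SelbergAxioms F a) {g : GammaFactor} (hg : g.Admissible F)
    (hd : g.degree < 1) (s : ℂ) :
    g.Q ^ s.re * ‖LSeries a s‖ = g.Q ^ (1 - s.re) * ‖LSeries a (1 - conj s)‖ := by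
  have hk := h.k_eq_zero_of_degree_lt_one hg hd
  have : IsEmpty (Fin g.k) := by rw [hk]; infer_instance
  have hcont := (h.differentiable_LSeries hg hd).continuous
  have hdense : Dense ({0, 1}ᶜ : Set ℂ) := (Set.toFinite _).countable.dense_compl ℂ
  have hQ := g.Q_pos.ne'
  refine congrFun (Continuous.ext_on hdense
    (f := fun s : ℂ => g.Q ^ s.re * ‖LSeries a s‖)
    (g := fun s : ℂ => g.Q ^ (1 - s.re) * ‖LSeries a (1 - conj s)‖) ?_ ?_ ?_) s
  · exact (continuous_const.rpow continuous_re fun _ => Or.inl hQ).mul hcont.norm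
  · refine (continuous_const.rpow (by fun_prop) fun _ => Or.inl hQ).mul (hcont.comp ?_).norm
    exact continuous_const.sub continuous_conj
  · intro s hs
    simp only [Set.mem_compl_iff, Set.mem_insert_iff, Set.mem_singleton_iff, not_or] at hs
    have h1 : 1 - conj s ≠ 1 := fun h => hs.1 (by simpa using h)
    have h2 := congrArg norm (hg s hs.1 hs.2 (fun ⟨i, _⟩ => isEmptyElim i)
      (fun ⟨i, _⟩ => isEmptyElim i))
    rw [RCLike.norm_conj, norm_mul, norm_mul, g.norm_toFun, g.norm_toFun,
      h.eq_LSeries_of_degree_lt_one hg hd hs.2, h.eq_LSeries_of_degree_lt_one hg hd h1] at h2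
    simpa using h2

/-- A function in the Selberg class of degree less than `1` is bounded above and below on
`Re s ≥ 1 / 2`. -/
theorem exists_exp_le_norm_LSeries_le (h : SelbergAxioms F a) {g : GammaFactor}
    (hg : g.Admissible F) (hd : g.degree < 1) : ∃ K : ℝ, 0 ≤ K ∧ ∀ s : ℂ, 1 / 2 ≤ s.re →
      Real.exp (-K) ≤ ‖LSeries a s‖ ∧ ‖LSeries a s‖ ≤ Real.exp K := by
  obtain ⟨b, θ, hθ, hbpp, hbO, hb⟩ := h.euler_product
  have hG := h.differentiable_LSeries hg hd
  have hsum : LSeriesSummable b (1 / 2 : ℝ) := by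
    obtain ⟨C, -, hC⟩ := Asymptotics.bound_of_isBigO_nat_atTop hbO
    refine LSeriesSummable_half_of_prime_pow_bounds hθ hbpp (C := C) (fun n hn => ?_) ?_
    · have hn0 : (0 : ℝ) < n := by positivity
      have hpos := Real.rpow_pos_of_pos hn0 θ
      have := hC hpos.ne'
      rwa [Real.norm_of_nonneg hpos.le] at this
    · obtain ⟨A, hA0, hA⟩ := h.exists_norm_coeff_le hg hd 2
      refine exists_norm_log_coeff_prime_pow_le hA0 (fun n hn => ?_) h.coeff_one
        (hbpp 1 not_isPrimePow_one) ?_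
      · have := hA n hn
        rwa [Real.rpow_neg (Nat.cast_nonneg _), Real.rpow_ofNat] at this
      · intro n hn
        refine LSeries.logMul_eq_convolution_of_eq_exp (x := 1) ?_ ?_ (fun s hs => ?_) hn
        · rw [h.abscissaOfAbsConv_eq_bot hg hd]; exact bot_le
        · exact LSeries.abscissaOfAbsConv_le_of_forall_lt_LSeriesSummable
            fun y hy => (hb y (by simpa using hy)).1
        · rw [← h.eq_LSeries hs, (hb s hs).2]
  have habs : LSeries.abscissaOfAbsConv b ≤ (1 / 2 : ℝ) := by
    simpa using hsum.abscissaOfAbsConv_le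
  have hsub : ∀ s : ℂ, 1 / 2 < s.re → LSeries.abscissaOfAbsConv b < s.re := fun s hs =>
    habs.trans_lt (by exact_mod_cast hs)
  have hEq : Set.EqOn (LSeries a) (fun s => exp (LSeries b s)) {s : ℂ | 1 / 2 < s.re} := by
    refine AnalyticOnNhd.eqOn_of_preconnected_of_eventuallyEq (fun z _ => hG.analyticAt z)
      (fun z hz => (LSeries_analyticOnNhd b z (hsub z hz)).cexp)
      (convex_halfSpace_re_gt _).isPreconnected (z₀ := 2) (by simp; norm_num) ?_
    filter_upwards [(isOpen_lt continuous_const continuous_re).mem_nhds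
      (show 1 < (2 : ℂ).re by norm_num)] with z hz
    rw [← h.eq_LSeries hz, (hb z hz).2]
  set K := ∑' n, ‖LSeries.term b (1 / 2 : ℝ) n‖ with hK
  refine ⟨K, tsum_nonneg fun _ => norm_nonneg _, fun s hs => ?_⟩
  -- `F = exp (log F)` is continued only to the open half-plane; the bounds reach the line `Re s =
  -- 1/2` by closure, so that this half-plane and its reflection cover `ℂ`.
  have hclosed : IsClosed {s : ℂ | Real.exp (-K) ≤ ‖LSeries a s‖ ∧ ‖LSeries a s‖ ≤ Real.exp K} :=
    (isClosed_le continuous_const hG.continuous.norm).inter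
      (isClosed_le hG.continuous.norm continuous_const)
  have hopen : {s : ℂ | 1 / 2 < s.re} ⊆
      {s : ℂ | Real.exp (-K) ≤ ‖LSeries a s‖ ∧ ‖LSeries a s‖ ≤ Real.exp K} := by
    intro s hs
    have hs' : 1 / 2 < s.re := hs
    have hbd : ‖LSeries b s‖ ≤ K := by
      refine (norm_tsum_le_tsum_norm
        (LSeriesSummable_of_abscissaOfAbsConv_lt_re (hsub s hs)).norm).trans ?_
      refine Summable.tsum_le_tsum (fun n => LSeries.norm_term_le_of_re_le_re b ?_ n)
        (LSeriesSummable_of_abscissaOfAbsConv_lt_re (hsub s hs)).norm hsum.norm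
      simpa using hs'.le
    have hre := abs_le.1 ((abs_re_le_norm _).trans hbd)
    rw [Set.mem_ofPred_eq, hEq hs, norm_exp, Real.exp_le_exp, Real.exp_le_exp]
    exact hre
  have := closure_minimal hopen hclosed
  rw [Complex.closure_setOfPred_lt_re] at this
  exact this hs

/-- The only function in the Selberg class of degree less than `1` is the constant `1`. -/
theorem eq_one_of_degree_lt_one (h : SelbergAxioms F a) {g : GammaFactor} (hg : g.Admissible F)
    (hd : g.degree < 1) {s : ℂ} (hs : s ≠ 1) : F s = 1 := by
  have hG := h.differentiable_LSeries hg hd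
  obtain ⟨K, hK0, hK⟩ := h.exists_exp_le_norm_LSeries_le hg hd
  have hQ := g.Q_pos
  have hfe : ∀ s : ℂ, ‖LSeries a s‖ = g.Q ^ (1 - 2 * s.re) * ‖LSeries a (1 - conj s)‖ := by
    intro s
    have h1 := h.norm_LSeries_mul_rpow_eq hg hd s
    have h2 : g.Q ^ (1 - s.re) = g.Q ^ s.re * g.Q ^ (1 - 2 * s.re) := by
      rw [← Real.rpow_add hQ]; congr 1; ring
    rw [h2, mul_assoc] at h1
    exact mul_left_cancel₀ (Real.rpow_pos_of_pos hQ _).ne' h1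
  have hrefl : ∀ s : ℂ, s.re ≤ 1 / 2 → 1 / 2 ≤ (1 - conj s).re := fun s hs => by
    simp; linarith
  have hne : ∀ s : ℂ, LSeries a s ≠ 0 := by
    intro s
    rw [← norm_pos_iff]
    rcases le_total (1 / 2) s.re with h1 | h1
    · exact (Real.exp_pos _).trans_le (hK s h1).1
    · rw [hfe]
      exact mul_pos (Real.rpow_pos_of_pos hQ _)
        ((Real.exp_pos _).trans_le (hK _ (hrefl s h1)).1)
  have hconst : ∀ z w : ℂ, LSeries a z = LSeries a w := by
    -- On `Re s ≤ 1/2` the factor `Q ^ (1 - 2 Re s)` is at most `1` if `Q ≤ 1` and at least `1` if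
    -- `Q ≥ 1`. Liouville applies to `F` in the first case and to `1/F` in the second.
    rcases le_total g.Q 1 with hQ1 | hQ1
    · refine hG.apply_eq_apply_of_bounded (isBounded_iff_forall_norm_le.2 ⟨Real.exp K, ?_⟩)
      rintro _ ⟨s, rfl⟩
      rcases le_total (1 / 2) s.re with h1 | h1
      · exact (hK s h1).2
      · rw [hfe]
        refine (mul_le_of_le_one_left (norm_nonneg _) ?_).trans (hK _ (hrefl s h1)).2
        exact Real.rpow_le_one hQ.le hQ1 (by linarith)
    · have hinv : Differentiable ℂ fun s => (LSeries a s)⁻¹ := fun s => (hG s).inv (hne s)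
      have := hinv.apply_eq_apply_of_bounded
        (isBounded_iff_forall_norm_le.2 ⟨Real.exp K, ?_⟩)
      · exact fun z w => inv_injective (this z w)
      rintro _ ⟨s, rfl⟩
      rw [norm_inv]
      refine inv_le_of_inv_le₀ (Real.exp_pos _) ?_
      rw [← Real.exp_neg]
      rcases le_total (1 / 2) s.re with h1 | h1
      · exact (hK s h1).1
      · rw [hfe]
        refine (hK _ (hrefl s h1)).1.trans (le_mul_of_one_le_left (norm_nonneg _) ?_)
        exact Real.one_le_rpow hQ1 (by linarith)
  -- The constant is read off as `Re s → ∞`, where only the term `a 1` survives.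
  have hlim := LSeries.tendsto_atTop (f := a) (by
    rw [h.abscissaOfAbsConv_eq_bot hg hd]; exact bot_lt_top)
  have hlim' : Tendsto (fun x : ℝ => LSeries a x) atTop (𝓝 (LSeries a s)) :=
    tendsto_const_nhds.congr fun x => hconst _ _
  rw [h.eq_LSeries_of_degree_lt_one hg hd hs, tendsto_nhds_unique hlim' hlim, h.coeff_one]

end SelbergAxioms

theorem corollary3p4 (F : ℂ → ℂ) (hF : F ∈ SelbergClass) (d : ℝ) (hd : HasDegree F d)
    (hd2 : d < 2) : IsPrimitive F := by
  refine ⟨hF, fun F₁ hF₁ F₂ hF₂ hmul => ?_⟩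
  obtain ⟨a, ha⟩ := hF
  obtain ⟨a₁, ha₁⟩ := hF₁
  obtain ⟨a₂, ha₂⟩ := hF₂
  obtain ⟨g, hg, rfl⟩ := hd
  obtain ⟨g₁, hg₁⟩ := ha₁.functional_equation
  obtain ⟨g₂, hg₂⟩ := ha₂.functional_equation
  have hdeg := hg.degree_add_le hg₁ hg₂ hmul fun s hs => ha.ne_zero hs
  rcases lt_or_ge g₁.degree 1 with h1 | h1
  · exact Or.inl fun s hs => ha₁.eq_one_of_degree_lt_one hg₁ h1 hs
  · exact Or.inr fun s hs => ha₂.eq_one_of_degree_lt_one hg₂ (by linarith) hs
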